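/- **Theorem.** Let $\mathbb H^1=\{(y,y')\in\mathbb R^2: y'=\sqrt{1+y^2}\}$ carry the Lorentz invariant measure $\sigma$, given by $\int\varphi\,d\sigma=\int_{\mathbb R}\varphi\big(y,\sqrt{1+y^2}\big)\frac{dy}{\sqrt{1+y^2}}$, and identify functions on $\mathbb H^1$ with functions of $y\in\mathbb R$, so that $\|f\|_{L^2(\mathbb H^1)}^2=\int_{\mathbb R}|f(y)|^2\frac{dy}{\sqrt{1+y^2}}$. For $f$ in the Schwartz class of $\mathbb R$ let $$Tf(x,t)=\int_{\mathbb R}e^{ixy}e^{it\sqrt{1+y^2}}f(y)\frac{dy}{\sqrt{1+y^2}},\qquad (x,t)\in\mathbb R^2 .$$ Then $T$ extends uniquely to a bounded linear operator $T:L^2(\mathbb H^1)\to L^6(\mathbb R^2)$ (on complex-valued functions), and the optimal constant $$\mathbf H_{1,6}:=\sup_{0\ne f\in L^2(\mathbb H^1)}\frac{\|Tf\|_{L^6(\mathbb R^2)}}{\|f\|_{L^2(\mathbb H^1)}}$$ equals $3^{-1/12}(2\pi)^{1/2}$. Moreover, there is no extremizer, that is, no nonzero $f\in L^2(\mathbb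 H^1)$ with $\|Tf\|_{L^6(\mathbb R^2)}=\mathbf H_{1,6}\,\|f\|_{L^2(\mathbb H^1)}$. -/

import Mathlib

open MeasureTheory
open scoped ENNReal

namespace Hyperbola

/-- The Lorentz invariant measure `dy / √(1 + y²)` on the hyperbola
`{(y, y') : y' = √(1 + y²)}`, which is parametrized by its first coordinate `y ∈ ℝ`. -/
noncomputable def sigma : Measure ℝ :=
  volume.withDensity fun y => ENNReal.ofReal (1 / √(1 + y ^ 2))

/-- The extension integral
`Tf(x,t) = ∫ e^{ixy} e^{it√(1+y²)} f(y) dy/√(1+y²)`, to be used for Schwartz functions `f`. -/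
noncomputable def extensionIntegral (f : ℝ → ℂ) (z : ℝ × ℝ) : ℂ :=
  ∫ y : ℝ, Complex.exp (Complex.I * ((z.1 * y : ℝ) : ℂ)) *
    Complex.exp (Complex.I * ((z.2 * √(1 + y ^ 2) : ℝ) : ℂ)) * f y / ((√(1 + y ^ 2) : ℝ) : ℂ)

/-- `T : L²(ℍ¹) → Lᵖ(ℝ²)` is a bounded linear operator that is given by the extension integral
on the (dense) class of Schwartz functions. -/
def IsExtensionOperator (p : ℝ≥0∞) [Fact (1 ≤ p)]
    (T : Lp ℂ 2 sigma →L[ℂ] Lp ℂ p (volume : Measure (ℝ × ℝ))) : Prop :=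
  ∀ (φ : SchwartzMap ℝ ℂ) (f : Lp ℂ 2 sigma), (f : ℝ → ℂ) =ᵐ[sigma] φ →
    (T f : ℝ × ℝ → ℂ) =ᵐ[volume] extensionIntegral φ

open Classical in
/-- The Fourier extension operator `T : L²(ℍ¹) → Lᵖ(ℝ²)`: the continuous extension to `L²(ℍ¹)` of
the extension integral (and `0` if there is none). -/
noncomputable def extensionOperator (p : ℝ≥0∞) [Fact (1 ≤ p)] :
    Lp ℂ 2 sigma →L[ℂ] Lp ℂ p (volume : Measure (ℝ × ℝ)) :=
  if h : ∃ T, IsExtensionOperator p T then h.choose else 0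

/-- The optimal constant `𝐇_{1,p} = sup_{0 ≠ f ∈ L²(ℍ¹)} ‖Tf‖_p / ‖f‖_2`, as an element
of `[0, ∞]`. -/
noncomputable def optimalConstant (p : ℝ≥0∞) [Fact (1 ≤ p)] : ℝ≥0∞ :=
  ⨆ (f : Lp ℂ 2 sigma) (_ : f ≠ 0), ‖extensionOperator p f‖ₑ / ‖f‖ₑ

/-- An extremizer: a nonzero `f ∈ L²(ℍ¹)` with `‖Tf‖_p = 𝐇_{1,p} ‖f‖_2`. -/
def IsExtremizer (p : ℝ≥0∞) [Fact (1 ≤ p)] (f : Lp ℂ 2 sigma) : Prop :=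
  f ≠ 0 ∧ ‖extensionOperator p f‖ₑ = optimalConstant p * ‖f‖ₑ

instance fact_one_le_six : Fact ((1 : ℝ≥0∞) ≤ 6) := ⟨by norm_num⟩

end Hyperbola

namespace Hyperbola

open Set Filter
open scoped InnerProductSpace FourierTransform Topology

/-! The exponent 6 is even, so `‖Tf‖_6^6` is the squared `L²` norm of `(Tf)³`, and `(Tf)³` is the
Fourier integral of the threefold convolution of `f σ`. Equivalently, `(Tf)³ = A* (f ⊗ f ⊗ f)`,
where `A` is the Fourier transform on the plane followed by composition with `frequency`. After the
factors of `2π`, the norm of `A` depends only on the density of `σ * σ * σ`.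

That density is a function of the invariant mass. In rapidities, the squared mass of a sum of three
points is `9 + 2 * excess a b`, and in suitable coordinates `excess` equals `p² + q²` plus positive
higher-order terms. For `p² + q²` alone the density would be the constant `2π/√3`. Since `sinh x >
x` for `x > 0`, `excess` grows strictly faster along each ray, so the true density is smaller
(`lintegral_ray`, `lintegral_momentum_lt`). Hence `A` satisfies a strict bound on every nonzero
vector. `norm_sq_adjoint_lt` passes strictness to `A*`, which gives both the upper bound and the
absence of extremizers (`norm_extensionL6_lt`).

The constant is optimal because the density tends to `2π/√3` at the threshold mass, which
corresponds to concentration at `y = 0`. Gaussians shrinking to that point become, after parabolic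
rescaling, a Gaussian Schrödinger wave whose `L⁶` norm is explicit and matches the bound
(`le_optimalConstant`). -/

/-! ### Rapidity coordinates for the threefold convolution of `sigma`. -/

lemma one_div_sqrt_nonneg (y : ℝ) : 0 ≤ 1 / √(1 + y ^ 2) := by positivity

lemma sqrt_one_add_sinh_sq (θ : ℝ) : √(1 + Real.sinh θ ^ 2) = Real.cosh θ := by
  rw [add_comm, ← Real.cosh_sq, Real.sqrt_sq (Real.cosh_pos θ).le]

lemma measurable_density :
    Measurable fun y : ℝ => ENNReal.ofReal (1 / √(1 + y ^ 2)) := by fun_prop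

/-- In the rapidity `θ = arsinh y` the measure `sigma` is Lebesgue measure. -/
lemma sigma_eq_map_sinh : sigma = Measure.map Real.sinh volume := by
  refine Measure.ext_of_lintegral _ fun g hg => ?_
  rw [lintegral_map hg Real.measurable_sinh, sigma,
    lintegral_withDensity_eq_lintegral_mul _ measurable_density hg]
  have h := lintegral_image_eq_lintegral_abs_deriv_mul (s := univ) MeasurableSet.univ
    (fun x _ => (Real.hasDerivAt_sinh x).hasDerivWithinAt) Real.sinh_injective.injOn
    ((fun y => ENNReal.ofReal (1 / √(1 + y ^ 2))) * g)
  rw [image_univ_of_surjective Real.sinh_surjective] at h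
  simp only [Measure.restrict_univ] at h
  rw [h]
  refine lintegral_congr fun θ => ?_
  simp only [Pi.mul_apply, sqrt_one_add_sinh_sq]
  rw [← mul_assoc, ← ENNReal.ofReal_mul (abs_nonneg _), abs_of_pos (Real.cosh_pos θ),
    mul_one_div_cancel (Real.cosh_pos θ).ne', ENNReal.ofReal_one, one_mul]

instance : SFinite sigma := by rw [sigma_eq_map_sinh]; infer_instance

/-- The measure `sigma ⊗ sigma ⊗ sigma`. -/
noncomputable def sigmaCube : Measure (ℝ × ℝ × ℝ) := sigma.prod (sigma.prod sigma)

/-- The sum of the points of the hyperbola above `y₁`, `y₂` and `y₃`. -/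
noncomputable def momentum (y : ℝ × ℝ × ℝ) : ℝ × ℝ :=
  (y.1 + y.2.1 + y.2.2, √(1 + y.1 ^ 2) + √(1 + y.2.1 ^ 2) + √(1 + y.2.2 ^ 2))

lemma continuous_momentum : Continuous momentum := by unfold momentum; fun_prop

lemma lintegral_sigmaCube {F : ℝ × ℝ × ℝ → ℝ≥0∞} (hF : Measurable F) :
    ∫⁻ y, F y ∂sigmaCube = ∫⁻ θ : ℝ, ∫⁻ a : ℝ, ∫⁻ b : ℝ,
      F (Real.sinh θ, Real.sinh a, Real.sinh b) := by
  have key : ∀ g : ℝ → ℝ≥0∞, Measurable g → ∫⁻ y, g y ∂sigma = ∫⁻ θ, g (Real.sinh θ) :=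
    fun g hg => by rw [sigma_eq_map_sinh, lintegral_map hg Real.measurable_sinh]
  rw [sigmaCube, lintegral_prod _ hF.aemeasurable, key _ hF.lintegral_prod_right']
  refine lintegral_congr fun θ => ?_
  have h1 : Measurable fun z : ℝ × ℝ => F (Real.sinh θ, z) := by fun_prop
  rw [lintegral_prod _ h1.aemeasurable, key _ h1.lintegral_prod_right']
  exact lintegral_congr fun a => key _ (by fun_prop)

/-- The excess of half the squared invariant mass over its minimum, as a function of the
differences of rapidities. -/
noncomputable def excess (a b : ℝ) : ℝ := Real.cosh a + Real.cosh b + Real.cosh (a - b) - 3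

lemma excess_nonneg (a b : ℝ) : 0 ≤ excess a b := by
  unfold excess
  linarith [Real.one_le_cosh a, Real.one_le_cosh b, Real.one_le_cosh (a - b)]

/-- The integral over a mass shell. -/
noncomputable def shellIntegral (h : ℝ × ℝ → ℝ≥0∞) (q : ℝ) : ℝ≥0∞ :=
  ∫⁻ α : ℝ, h (√(9 + 2 * q) * Real.sinh α, √(9 + 2 * q) * Real.cosh α)

lemma measurable_shellIntegral {h : ℝ × ℝ → ℝ≥0∞} (hh : Measurable h) :
    Measurable (shellIntegral h) := by
  have : Measurable fun z : ℝ × ℝ =>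
      h (√(9 + 2 * z.1) * Real.sinh z.2, √(9 + 2 * z.1) * Real.cosh z.2) := by
    fun_prop
  exact this.lintegral_prod_right'

/-- The sum of the three points is the boost by `θ` of the vector `(sinh a + sinh b, 1 + cosh a +
cosh b)`. That vector has Lorentz length `s` and rapidity `c`, and translation invariance in `θ`
removes `c`. -/
lemma lintegral_rapidity (h : ℝ × ℝ → ℝ≥0∞) (a b : ℝ) :
    ∫⁻ θ : ℝ, h (Real.sinh θ + Real.sinh (θ + a) + Real.sinh (θ + b),
      Real.cosh θ + Real.cosh (θ + a) + Real.cosh (θ + b)) = shellIntegral h (excess a b) := by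
  set s := √(9 + 2 * excess a b) with hs
  have hpos : 0 < 9 + 2 * excess a b := by linarith [excess_nonneg a b]
  have hs0 : 0 < s := Real.sqrt_pos.2 hpos
  have hs2 : s ^ 2 = (1 + Real.cosh a + Real.cosh b) ^ 2 - (Real.sinh a + Real.sinh b) ^ 2 := by
    rw [hs, Real.sq_sqrt hpos.le, excess, Real.cosh_sub]
    nlinarith [Real.cosh_sq a, Real.cosh_sq b]
  set c := Real.arsinh ((Real.sinh a + Real.sinh b) / s) with hc
  have hB : s * Real.sinh c = Real.sinh a + Real.sinh b := by
    rw [hc, Real.sinh_arsinh]; field_simp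
  have hA : s * Real.cosh c = 1 + Real.cosh a + Real.cosh b := by
    have h1 : (s * Real.cosh c) ^ 2 = (1 + Real.cosh a + Real.cosh b) ^ 2 := by
      rw [mul_pow, Real.cosh_sq, mul_add, ← mul_pow, hB, hs2]; ring
    exact (pow_left_inj₀ (mul_pos hs0 (Real.cosh_pos c)).le
      (by linarith [Real.cosh_pos a, Real.cosh_pos b]) two_ne_zero).1 h1
  rw [shellIntegral, ← hs,
    ← lintegral_add_right_eq_self (fun α => h (s * Real.sinh α, s * Real.cosh α)) c]
  refine lintegral_congr fun θ => ?_
  congr 2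
  · rw [Real.sinh_add θ c, Real.sinh_add θ a, Real.sinh_add θ b]
    linear_combination (-Real.sinh θ) * hA - Real.cosh θ * hB
  · rw [Real.cosh_add θ c, Real.cosh_add θ a, Real.cosh_add θ b]
    linear_combination (-Real.cosh θ) * hA - Real.sinh θ * hB

lemma lintegral_momentum_eq_excess {h : ℝ × ℝ → ℝ≥0∞} (hh : Measurable h) :
    ∫⁻ y, h (momentum y) ∂sigmaCube = ∫⁻ b : ℝ, ∫⁻ a : ℝ, shellIntegral h (excess a b) := by
  rw [lintegral_sigmaCube (F := fun y => h (momentum y)) (hh.comp continuous_momentum.measurable)]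
  simp only [momentum, sqrt_one_add_sinh_sq]
  have hF : Measurable fun z : ℝ × ℝ × ℝ =>
      h (Real.sinh z.1 + Real.sinh (z.1 + z.2.1) + Real.sinh (z.1 + z.2.2),
        Real.cosh z.1 + Real.cosh (z.1 + z.2.1) + Real.cosh (z.1 + z.2.2)) := by
    fun_prop
  calc _ = ∫⁻ θ : ℝ, ∫⁻ a : ℝ, ∫⁻ b : ℝ,
        h (Real.sinh θ + Real.sinh (θ + a) + Real.sinh (θ + b),
          Real.cosh θ + Real.cosh (θ + a) + Real.cosh (θ + b)) := by
        refine lintegral_congr fun θ => ?_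
        -- Measuring the second and third rapidities from the first isolates the boost `θ` as a free
        -- variable.
        rw [← lintegral_add_left_eq_self _ θ]
        refine lintegral_congr fun a => ?_
        rw [← lintegral_add_left_eq_self _ θ]
    _ = ∫⁻ θ : ℝ, ∫⁻ z : ℝ × ℝ,
        h (Real.sinh θ + Real.sinh (θ + z.1) + Real.sinh (θ + z.2),
          Real.cosh θ + Real.cosh (θ + z.1) + Real.cosh (θ + z.2)) := by
        refine lintegral_congr fun θ => ?_
        rw [Measure.volume_eq_prod, lintegral_prod]
        exact (hF.comp (measurable_prodMk_left (x := θ))).aemeasurable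
    _ = ∫⁻ z : ℝ × ℝ, shellIntegral h (excess z.1 z.2) := by
        rw [lintegral_lintegral_swap hF.aemeasurable]
        exact lintegral_congr fun z => lintegral_rapidity h z.1 z.2
    _ = _ := by
        rw [Measure.volume_eq_prod, lintegral_prod_symm]
        refine Measurable.aemeasurable ?_
        refine (measurable_shellIntegral hh).comp ?_
        unfold excess
        fun_prop

lemma lintegral_comp_mul_left {c : ℝ} (hc : 0 < c) (g : ℝ → ℝ≥0∞) :
    ∫⁻ x, g x = ENNReal.ofReal c * ∫⁻ x, g (c * x) := by
  have h := lintegral_image_eq_lintegral_abs_deriv_mul (s := univ) (f := fun x => c * x)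
    (f' := fun _ => c) MeasurableSet.univ
    (fun x _ => (by simpa using (hasDerivAt_id x).const_mul c : HasDerivAt _ c x).hasDerivWithinAt)
    (fun x _ y _ hxy => mul_left_cancel₀ hc.ne' hxy) g
  rw [image_univ_of_surjective (fun y => ⟨c⁻¹ * y, by field_simp⟩)] at h
  simp only [Measure.restrict_univ] at h
  rw [h, abs_of_pos hc, lintegral_const_mul' _ _ ENNReal.ofReal_ne_top]

/-- `excess` in coordinates in which its quadratic part is `p ^ 2 + q ^ 2`. -/
noncomputable def excessRound (z : ℝ × ℝ) : ℝ := excess (z.1 + z.2 / √3) (2 / √3 * z.2)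

/-- The factor `2 / √3` is the Jacobian of `(p, q) ↦ (p + q/√3, 2q/√3)`, the linear map that turns
`(a² + b² + (a - b)²)/2` into `p² + q²`. -/
lemma lintegral_momentum_eq_excessRound {h : ℝ × ℝ → ℝ≥0∞} (hh : Measurable h) :
    ∫⁻ y, h (momentum y) ∂sigmaCube =
      ENNReal.ofReal (2 / √3) * ∫⁻ z : ℝ × ℝ, shellIntegral h (excessRound z) := by
  rw [lintegral_momentum_eq_excess hh, lintegral_comp_mul_left (c := 2 / √3) (by positivity),
    Measure.volume_eq_prod, lintegral_prod_symm]
  · congr 1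
    refine lintegral_congr fun q => ?_
    rw [← lintegral_add_right_eq_self _ (q / √3)]
    rfl
  · refine Measurable.aemeasurable ?_
    refine (measurable_shellIntegral hh).comp ?_
    unfold excessRound excess
    fun_prop

/-! ### Radial comparison of `excess` with its quadratic part. -/

lemma sq_le_mul_sinh (x : ℝ) : x ^ 2 ≤ x * Real.sinh x := by
  rcases le_total 0 x with hx | hx
  · nlinarith [Real.self_le_sinh_iff.2 hx]
  · nlinarith [Real.sinh_le_self_iff.2 hx]

lemma sq_lt_mul_sinh {x : ℝ} (hx : x ≠ 0) : x ^ 2 < x * Real.sinh x := by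
  rcases lt_or_gt_of_ne hx with hx | hx
  · nlinarith [Real.sinh_lt_self_iff.2 hx]
  · nlinarith [Real.self_lt_sinh_iff.2 hx]

section Ray

variable (a b c : ℝ)

lemma hasDerivAt_cosh_sum (r : ℝ) :
    HasDerivAt (fun r => Real.cosh (r * a) + Real.cosh (r * b) + Real.cosh (r * c) - 3)
      (a * Real.sinh (r * a) + b * Real.sinh (r * b) + c * Real.sinh (r * c)) r := by
  have h : ∀ a : ℝ, HasDerivAt (fun r : ℝ => Real.cosh (r * a)) (a * Real.sinh (r * a)) r :=
    fun a => by
      have := ((hasDerivAt_id r).mul_const a).cosh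
      simpa [mul_comm] using this
  exact (((h a).add (h b)).add (h c)).sub_const 3

variable {a b c}

/-- Apply `sinh x ≥ x` to each term. The normalization forces one of `a`, `b`, `c` to be nonzero,
and that term is strict. -/
lemma two_mul_lt_deriv (habc : a ^ 2 + b ^ 2 + c ^ 2 = 2) {r : ℝ} (hr : 0 < r) :
    2 * r < a * Real.sinh (r * a) + b * Real.sinh (r * b) + c * Real.sinh (r * c) := by
  have hle : ∀ x : ℝ, r * x ^ 2 ≤ x * Real.sinh (r * x) := fun x => by
    have := sq_le_mul_sinh (r * x)
    have : r * (r * x ^ 2) ≤ r * (x * Real.sinh (r * x)) := by linarith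
    exact le_of_mul_le_mul_left this hr
  have hlt : ∀ x : ℝ, x ≠ 0 → r * x ^ 2 < x * Real.sinh (r * x) := fun x hx => by
    have := sq_lt_mul_sinh (mul_ne_zero hr.ne' hx)
    have : r * (r * x ^ 2) < r * (x * Real.sinh (r * x)) := by linarith
    exact lt_of_mul_lt_mul_left this hr.le
  have hsum : 2 * r = r * a ^ 2 + r * b ^ 2 + r * c ^ 2 := by rw [← habc]; ring
  rw [hsum]
  by_cases ha : a = 0
  · by_cases hb : b = 0
    · have hc : c ≠ 0 := by rintro rfl; simp [ha, hb] at habc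
      linarith [hle a, hle b, hlt c hc]
    · linarith [hle a, hlt b hb, hle c]
  · linarith [hlt a ha, hle b, hle c]

/-- Comparison of the radial integral of a function of
`cosh (r a) + cosh (r b) + cosh (r c) - 3` with that of its quadratic part. -/
lemma lintegral_ray (habc : a ^ 2 + b ^ 2 + c ^ 2 = 2) {g : ℝ → ℝ≥0∞} (hg : Measurable g) :
    (2 * ∫⁻ r in Ioi (0 : ℝ), ENNReal.ofReal r *
        g (Real.cosh (r * a) + Real.cosh (r * b) + Real.cosh (r * c) - 3) ≤
      ∫⁻ q in Ioi (0 : ℝ), g q) ∧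
    (∫⁻ q in Ioi (0 : ℝ), g q ≠ 0 → ∫⁻ q in Ioi (0 : ℝ), g q ≠ ∞ →
      2 * ∫⁻ r in Ioi (0 : ℝ), ENNReal.ofReal r *
        g (Real.cosh (r * a) + Real.cosh (r * b) + Real.cosh (r * c) - 3) <
      ∫⁻ q in Ioi (0 : ℝ), g q) := by
  set k : ℝ → ℝ := fun r => Real.cosh (r * a) + Real.cosh (r * b) + Real.cosh (r * c) - 3 with hk
  set k' : ℝ → ℝ := fun r =>
    a * Real.sinh (r * a) + b * Real.sinh (r * b) + c * Real.sinh (r * c) with hk'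
  have hderiv : ∀ r, HasDerivAt k (k' r) r := hasDerivAt_cosh_sum a b c
  have hcont : Continuous k := by fun_prop
  have hk'pos : ∀ r, 0 < r → 2 * r < k' r := fun r hr => two_mul_lt_deriv habc hr
  have hmono : StrictMonoOn k (Ici 0) := by
    refine strictMonoOn_of_deriv_pos (convex_Ici 0) hcont.continuousOn fun r hr => ?_
    rw [interior_Ici] at hr
    rw [(hderiv r).deriv]
    linarith [hk'pos r hr, mem_Ioi.1 hr]
  have himage : k '' Ioi 0 ⊆ Ioi 0 := by
    rintro _ ⟨r, hr, rfl⟩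
    have := hmono self_mem_Ici (Ioi_subset_Ici_self hr) hr
    have h0 : k 0 = 0 := by norm_num [hk]
    rwa [h0] at this
  -- The substitution `q = k r` gives `dq = k' r dr`, and `k' r > 2 r`.
  have hchange : ∫⁻ q in k '' Ioi 0, g q =
      ∫⁻ r in Ioi (0 : ℝ), ENNReal.ofReal |k' r| * g (k r) :=
    lintegral_image_eq_lintegral_abs_deriv_mul measurableSet_Ioi
      (fun r _ => (hderiv r).hasDerivWithinAt) (hmono.injOn.mono Ioi_subset_Ici_self) g
  have hle' : ∫⁻ r in Ioi (0 : ℝ), ENNReal.ofReal |k' r| * g (k r) ≤ ∫⁻ q in Ioi (0 : ℝ), g q := by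
    rw [← hchange]
    exact lintegral_mono_set himage
  have htwo : 2 * ∫⁻ r in Ioi (0 : ℝ), ENNReal.ofReal r * g (k r) =
      ∫⁻ r in Ioi (0 : ℝ), ENNReal.ofReal (2 * r) * g (k r) := by
    rw [← lintegral_const_mul' _ _ (by simp)]
    refine lintegral_congr fun r => ?_
    rw [ENNReal.ofReal_mul zero_le_two, ENNReal.ofReal_ofNat, mul_assoc]
  have hpt : ∀ r ∈ Ioi (0 : ℝ),
      ENNReal.ofReal (2 * r) * g (k r) ≤ ENNReal.ofReal |k' r| * g (k r) := fun r hr => by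
    gcongr
    exact (hk'pos r hr).le.trans (le_abs_self _)
  have hpt_ae : (fun r => ENNReal.ofReal (2 * r) * g (k r)) ≤ᵐ[volume.restrict (Ioi 0)]
      fun r => ENNReal.ofReal |k' r| * g (k r) := ae_restrict_of_forall_mem measurableSet_Ioi hpt
  have hmeas' : Measurable fun r => ENNReal.ofReal |k' r| * g (k r) := by
    have : Measurable k' := by fun_prop
    fun_prop
  have hmeas : Measurable fun r => ENNReal.ofReal (2 * r) * g (k r) := by fun_prop
  rw [htwo]
  refine ⟨(lintegral_mono_ae hpt_ae).trans hle', fun h0 hfin => ?_⟩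
  by_contra hcon
  have heq : ∫⁻ r in Ioi (0 : ℝ), ENNReal.ofReal |k' r| * g (k r) ≤
      ∫⁻ r in Ioi (0 : ℝ), ENNReal.ofReal (2 * r) * g (k r) := hle'.trans (not_lt.1 hcon)
  have hfin' := ne_top_of_le_ne_top hfin hle'
  have hae := ae_eq_of_ae_le_of_lintegral_le hpt_ae
    (ne_top_of_le_ne_top hfin' (lintegral_mono_ae hpt_ae)) hmeas'.aemeasurable heq
  -- Since the weights `2 r` and `k' r` differ strictly, equality of the integrals forces `g ∘ k` to
  -- vanish almost everywhere. The left side would then be zero, hence still below a nonzero right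
  -- side.
  have hzero : (fun r => ENNReal.ofReal (2 * r) * g (k r)) =ᵐ[volume.restrict (Ioi 0)] 0 := by
    filter_upwards [hae, ae_lt_top hmeas' hfin', ae_restrict_mem measurableSet_Ioi]
      with r hr hlt hr0
    have hr0' : 0 < r := hr0
    have hlt' : ENNReal.ofReal (2 * r) < ENNReal.ofReal |k' r| :=
      (ENNReal.ofReal_lt_ofReal_iff_of_nonneg (by positivity)).2
        ((hk'pos r hr0).trans_le (le_abs_self _))
    by_contra hne
    have hg0 : g (k r) ≠ 0 := fun h => hne (by simp [h])
    have hgtop : g (k r) ≠ ∞ := fun h => by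
      rw [h, ENNReal.mul_top (hlt'.bot_lt).ne'] at hlt
      exact lt_irrefl _ hlt
    exact ((ENNReal.mul_lt_mul_iff_left hg0 hgtop).2 hlt').ne hr
  refine hcon ?_
  rw [lintegral_congr_ae hzero]
  simpa [pos_iff_ne_zero] using h0

end Ray

lemma excessRound_polar (r φ : ℝ) :
    excessRound (r * Real.cos φ, r * Real.sin φ) =
      Real.cosh (r * (Real.cos φ + Real.sin φ / √3)) + Real.cosh (r * (2 / √3 * Real.sin φ)) +
        Real.cosh (r * (Real.cos φ - Real.sin φ / √3)) - 3 := by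
  simp only [excessRound, excess]
  congr 4 <;> ring

lemma lintegral_excessRound {g : ℝ → ℝ≥0∞} (hg : Measurable g) :
    (∫⁻ z : ℝ × ℝ, g (excessRound z) ≤ ENNReal.ofReal Real.pi * ∫⁻ q in Ioi (0 : ℝ), g q) ∧
    (∫⁻ q in Ioi (0 : ℝ), g q ≠ 0 → ∫⁻ q in Ioi (0 : ℝ), g q ≠ ∞ →
      ∫⁻ z : ℝ × ℝ, g (excessRound z) < ENNReal.ofReal Real.pi * ∫⁻ q in Ioi (0 : ℝ), g q) := by
  have hmeas : Measurable excessRound := by unfold excessRound excess; fun_prop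
  set R : ℝ → ℝ≥0∞ := fun φ => ∫⁻ r in Ioi (0 : ℝ), ENNReal.ofReal r *
        g (Real.cosh (r * (Real.cos φ + Real.sin φ / √3)) + Real.cosh (r * (2 / √3 * Real.sin φ)) +
        Real.cosh (r * (Real.cos φ - Real.sin φ / √3)) - 3) with hR
  set I := ∫⁻ q in Ioi (0 : ℝ), g q with hI
  -- The squares sum to `2` in every direction, so each ray contributes at most half of `I`.
  -- Integrating over angles gives `π * I`.
  have hsum : ∀ φ : ℝ, (Real.cos φ + Real.sin φ / √3) ^ 2 + (2 / √3 * Real.sin φ) ^ 2 +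
      (Real.cos φ - Real.sin φ / √3) ^ 2 = 2 := fun φ => by
    have h3 : √(3 : ℝ) ^ 2 = 3 := Real.sq_sqrt (by norm_num)
    field_simp
    rw [h3]
    nlinarith [Real.sin_sq_add_cos_sq φ]
  have hray := fun φ => lintegral_ray (hsum φ) hg
  have hpolar : ∫⁻ z : ℝ × ℝ, g (excessRound z) = ∫⁻ φ in Ioo (-Real.pi) Real.pi, R φ := by
    rw [← lintegral_comp_polarCoord_symm, polarCoord_target, Measure.volume_eq_prod,
      ← Measure.prod_restrict, lintegral_prod_symm]
    · refine lintegral_congr fun φ => lintegral_congr fun r => ?_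
      simp only [polarCoord_symm_apply, smul_eq_mul, excessRound_polar]
    · refine Measurable.aemeasurable ?_
      simp only [polarCoord_symm_apply, smul_eq_mul]
      fun_prop
  have hvol : ∫⁻ _ in Ioo (-Real.pi) Real.pi, I = 2 * (ENNReal.ofReal Real.pi * I) := by
    rw [setLIntegral_const, Real.volume_Ioo, mul_comm, ← mul_assoc]
    congr 1
    rw [show Real.pi - -Real.pi = 2 * Real.pi by ring, ENNReal.ofReal_mul zero_le_two,
      ENNReal.ofReal_ofNat]
  have hdouble : 2 * ∫⁻ z : ℝ × ℝ, g (excessRound z) =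
      ∫⁻ φ in Ioo (-Real.pi) Real.pi, 2 * R φ := by
    rw [hpolar, lintegral_const_mul' _ _ (by simp)]
  have hle : ∫⁻ z : ℝ × ℝ, g (excessRound z) ≤ ENNReal.ofReal Real.pi * I := by
    rw [← ENNReal.mul_le_mul_iff_right two_ne_zero ENNReal.ofNat_ne_top, hdouble, ← hvol]
    exact lintegral_mono fun φ => (hray φ).1
  refine ⟨hle, fun h0 hfin => ?_⟩
  rw [← ENNReal.mul_lt_mul_iff_right two_ne_zero ENNReal.ofNat_ne_top, hdouble, ← hvol]
  refine lintegral_strict_mono ?_ aemeasurable_const ?_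
    (Filter.Eventually.of_forall fun φ => (hray φ).2 h0 hfin)
  · simp [Real.pi_pos]
  · rw [← hdouble]
    exact ENNReal.mul_ne_top (by simp)
      (ne_top_of_le_ne_top (ENNReal.mul_ne_top ENNReal.ofReal_ne_top hfin) hle)

/-! ### From mass shells to the momentum plane: the bound on the density. -/

lemma shellIntegral_eq (h : ℝ × ℝ → ℝ≥0∞) {q : ℝ} (hq : 0 < q) :
    shellIntegral h q = ∫⁻ ξ : ℝ, ENNReal.ofReal (1 / √(9 + 2 * q + ξ ^ 2)) *
      h (ξ, √(9 + 2 * q + ξ ^ 2)) := by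
  set s := √(9 + 2 * q) with hs
  have hpos : 0 < 9 + 2 * q := by linarith
  have hs0 : 0 < s := Real.sqrt_pos.2 hpos
  have hs2 : s ^ 2 = 9 + 2 * q := Real.sq_sqrt hpos.le
  have hc := lintegral_image_eq_lintegral_abs_deriv_mul (s := univ) MeasurableSet.univ
    (fun x _ => ((Real.hasDerivAt_sinh x).const_mul s).hasDerivWithinAt)
    (fun x _ y _ hxy => Real.sinh_injective (mul_left_cancel₀ hs0.ne' hxy))
    (fun ξ => ENNReal.ofReal (1 / √(9 + 2 * q + ξ ^ 2)) * h (ξ, √(9 + 2 * q + ξ ^ 2)))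
  rw [image_univ_of_surjective (fun y => ⟨Real.arsinh (y / s), by
    rw [Real.sinh_arsinh]; field_simp⟩)] at hc
  simp only [Measure.restrict_univ] at hc
  rw [hc, shellIntegral]
  refine lintegral_congr fun α => ?_
  have hsc : 0 < s * Real.cosh α := mul_pos hs0 (Real.cosh_pos α)
  have : √(9 + 2 * q + (s * Real.sinh α) ^ 2) = s * Real.cosh α := by
    rw [← hs2, show s ^ 2 + (s * Real.sinh α) ^ 2 = s ^ 2 * (Real.sinh α ^ 2 + 1) by ring,
      ← Real.cosh_sq, ← mul_pow, Real.sqrt_sq hsc.le]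
  rw [this, ← mul_assoc, ← ENNReal.ofReal_mul (abs_nonneg _), abs_of_pos hsc,
    mul_one_div_cancel hsc.ne', ENNReal.ofReal_one, one_mul]

/-- For fixed `ξ`, the weight `1 / √(9 + 2q + ξ²)` is the derivative of `τ = √(9 + 2q + ξ²)` in `q`.
The shells therefore fill only the region `τ > √(9 + ξ²)`, whence an inequality. -/
lemma lintegral_shellIntegral_le {h : ℝ × ℝ → ℝ≥0∞} (hh : Measurable h) :
    ∫⁻ q in Ioi (0 : ℝ), shellIntegral h q ≤ ∫⁻ z, h z := by
  rw [setLIntegral_congr_fun measurableSet_Ioi fun q hq => shellIntegral_eq h hq,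
    lintegral_lintegral_swap (by fun_prop), Measure.volume_eq_prod,
    lintegral_prod _ hh.aemeasurable]
  refine lintegral_mono fun ξ => ?_
  have hpos : ∀ q ∈ Ioi (0 : ℝ), 0 < 9 + 2 * q + ξ ^ 2 := fun q hq => by
    have : (0 : ℝ) < q := hq
    positivity
  have hd : ∀ q ∈ Ioi (0 : ℝ), HasDerivWithinAt (fun q => √(9 + 2 * q + ξ ^ 2))
      (1 / √(9 + 2 * q + ξ ^ 2)) (Ioi 0) q := fun q hq => by
    have h1 : HasDerivAt (fun q : ℝ => 9 + 2 * q + ξ ^ 2) 2 q := by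
      simpa using (((hasDerivAt_id q).const_mul 2).const_add 9).add_const (ξ ^ 2)
    have := (h1.sqrt (hpos q hq).ne').hasDerivWithinAt (s := Ioi 0)
    convert! this using 1
    field_simp
  have hinj : InjOn (fun q => √(9 + 2 * q + ξ ^ 2)) (Ioi 0) := fun p hp q hq hpq => by
    have := (Real.sqrt_inj (hpos p hp).le (hpos q hq).le).1 hpq
    linarith
  have hc := lintegral_image_eq_lintegral_abs_deriv_mul measurableSet_Ioi hd hinj
    (fun τ => h (ξ, τ))
  calc _ = ∫⁻ τ in (fun q => √(9 + 2 * q + ξ ^ 2)) '' Ioi 0, h (ξ, τ) := by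
        rw [hc]
        refine lintegral_congr fun q => ?_
        rw [abs_of_nonneg (by positivity)]
    _ ≤ _ := setLIntegral_le_lintegral _ _

lemma ofReal_two_pi_div_sqrt_three :
    ENNReal.ofReal (2 * Real.pi / √3) = ENNReal.ofReal (2 / √3) * ENNReal.ofReal Real.pi := by
  rw [← ENNReal.ofReal_mul (by positivity)]; congr 1; ring

/-- The density of `σ * σ * σ` is at most `2 π / √3`. -/
theorem lintegral_momentum_le {h : ℝ × ℝ → ℝ≥0∞} (hh : Measurable h) :
    ∫⁻ y, h (momentum y) ∂sigmaCube ≤ ENNReal.ofReal (2 * Real.pi / √3) * ∫⁻ z, h z := by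
  rw [lintegral_momentum_eq_excessRound hh, ofReal_two_pi_div_sqrt_three, mul_assoc]
  gcongr
  refine (lintegral_excessRound (measurable_shellIntegral hh)).1.trans ?_
  gcongr
  exact lintegral_shellIntegral_le hh

/-- The density of `σ * σ * σ` is less than `2 π / √3` almost everywhere. -/
theorem lintegral_momentum_lt {h : ℝ × ℝ → ℝ≥0∞} (hh : Measurable h)
    (h0 : ∫⁻ z, h z ≠ 0) (hfin : ∫⁻ z, h z ≠ ∞) :
    ∫⁻ y, h (momentum y) ∂sigmaCube < ENNReal.ofReal (2 * Real.pi / √3) * ∫⁻ z, h z := by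
  have hpi : ENNReal.ofReal Real.pi ≠ 0 := by simp [Real.pi_pos]
  have hsq : ENNReal.ofReal (2 / √3) ≠ 0 := by simp
  rw [lintegral_momentum_eq_excessRound hh, ofReal_two_pi_div_sqrt_three, mul_assoc,
    ENNReal.mul_lt_mul_iff_right hsq ENNReal.ofReal_ne_top]
  have hle := lintegral_shellIntegral_le hh
  have hexc := lintegral_excessRound (measurable_shellIntegral hh)
  -- If `h` has no mass above the threshold shell, strictness comes from the positivity of the right
  -- side instead of the ray comparison.
  by_cases hS : ∫⁻ q in Ioi (0 : ℝ), shellIntegral h q = 0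
  · refine (hexc.1.trans_eq (by rw [hS, mul_zero])).trans_lt ?_
    exact ENNReal.mul_pos hpi h0
  · refine (hexc.2 hS (ne_top_of_le_ne_top hfin hle)).trans_le ?_
    gcongr

/-! ### Tensor products of `L²` functions. -/

section Tensor

variable {α β : Type*} [MeasurableSpace α] [MeasurableSpace β] {μ : Measure α} {ν : Measure β}

lemma aestronglyMeasurable_tensor {f : α → ℂ} {g : β → ℂ} (hf : AEStronglyMeasurable f μ)
    (hg : AEStronglyMeasurable g ν) :
    AEStronglyMeasurable (fun z : α × β => f z.1 * g z.2) (μ.prod ν) :=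
  hf.comp_fst.mul hg.comp_snd

lemma eLpNorm_tensor [SFinite ν] {f : α → ℂ} {g : β → ℂ} (hf : AEStronglyMeasurable f μ)
    (hg : AEStronglyMeasurable g ν) :
    eLpNorm (fun z : α × β => f z.1 * g z.2) 2 (μ.prod ν) = eLpNorm f 2 μ * eLpNorm g 2 ν := by
  simp only [eLpNorm_eq_lintegral_rpow_enorm_toReal two_ne_zero ENNReal.ofNat_ne_top, enorm_mul,
    ENNReal.toReal_ofNat]
  rw [← ENNReal.mul_rpow_of_nonneg _ _ (by norm_num),
    ← lintegral_prod_mul (hf.enorm.pow_const _) (hg.enorm.pow_const _)]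
  congr 1
  exact lintegral_congr fun z => ENNReal.mul_rpow_of_nonneg _ _ (by norm_num)

lemma memLp_tensor [SFinite ν] {f : α → ℂ} {g : β → ℂ} (hf : MemLp f 2 μ) (hg : MemLp g 2 ν) :
    MemLp (fun z : α × β => f z.1 * g z.2) 2 (μ.prod ν) :=
  ⟨aestronglyMeasurable_tensor hf.1 hg.1, by
    rw [eLpNorm_tensor hf.1 hg.1]; exact ENNReal.mul_lt_top hf.2 hg.2⟩

lemma ae_prod_fst {p : α → Prop} (h : ∀ᵐ x ∂μ, p x) : ∀ᵐ z ∂μ.prod ν, p z.1 :=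
  Measure.quasiMeasurePreserving_fst.ae h

lemma ae_prod_snd {p : β → Prop} (h : ∀ᵐ x ∂ν, p x) : ∀ᵐ z ∂μ.prod ν, p z.2 :=
  Measure.quasiMeasurePreserving_snd.ae h

variable [SFinite ν]

variable (μ ν) in
/-- The tensor product of functions as a bilinear map `L² × L² → L²`. -/
noncomputable def tensorₗ : Lp ℂ 2 μ →ₗ[ℂ] Lp ℂ 2 ν →ₗ[ℂ] Lp ℂ 2 (μ.prod ν) :=
  LinearMap.mk₂ ℂ (fun f g => (memLp_tensor (Lp.memLp f) (Lp.memLp g)).toLp _)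
    (fun f f' g => by
      rw [← MemLp.toLp_add]
      refine MemLp.toLp_congr _ _ ?_
      filter_upwards [ae_prod_fst (Lp.coeFn_add f f')] with z hz
      rw [hz, Pi.add_apply, add_mul, Pi.add_apply])
    (fun c f g => by
      rw [← MemLp.toLp_const_smul]
      refine MemLp.toLp_congr _ _ ?_
      filter_upwards [ae_prod_fst (Lp.coeFn_smul c f)] with z hz
      simp [hz, mul_assoc])
    (fun f g g' => by
      rw [← MemLp.toLp_add]
      refine MemLp.toLp_congr _ _ ?_
      filter_upwards [ae_prod_snd (Lp.coeFn_add g g')] with z hz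
      rw [hz, Pi.add_apply, mul_add, Pi.add_apply])
    (fun c f g => by
      rw [← MemLp.toLp_const_smul]
      refine MemLp.toLp_congr _ _ ?_
      filter_upwards [ae_prod_snd (Lp.coeFn_smul c g)] with z hz
      simp [hz, mul_left_comm])

lemma norm_tensorₗ (f : Lp ℂ 2 μ) (g : Lp ℂ 2 ν) : ‖tensorₗ μ ν f g‖ = ‖f‖ * ‖g‖ := by
  rw [tensorₗ, LinearMap.mk₂_apply, Lp.norm_toLp, eLpNorm_tensor (Lp.memLp f).1 (Lp.memLp g).1,
    ENNReal.toReal_mul, Lp.norm_def, Lp.norm_def]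

variable (μ ν) in
/-- The tensor product of functions as a bounded bilinear map `L² × L² → L²`. -/
noncomputable def tensor : Lp ℂ 2 μ →L[ℂ] Lp ℂ 2 ν →L[ℂ] Lp ℂ 2 (μ.prod ν) :=
  LinearMap.mkContinuous₂ (tensorₗ μ ν) 1 fun f g => by rw [norm_tensorₗ, one_mul]

lemma norm_tensor (f : Lp ℂ 2 μ) (g : Lp ℂ 2 ν) : ‖tensor μ ν f g‖ = ‖f‖ * ‖g‖ :=
  norm_tensorₗ f g

lemma coeFn_tensor (f : Lp ℂ 2 μ) (g : Lp ℂ 2 ν) :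
    tensor μ ν f g =ᵐ[μ.prod ν] fun z => f z.1 * g z.2 :=
  MemLp.coeFn_toLp (memLp_tensor (Lp.memLp f) (Lp.memLp g))

end Tensor

/-- The function `f ⊗ f ⊗ f`. -/
noncomputable def tensorCube (f : Lp ℂ 2 sigma) : Lp ℂ 2 sigmaCube :=
  tensor sigma (sigma.prod sigma) f (tensor sigma sigma f f)

lemma continuous_tensorCube : Continuous tensorCube := by
  have h2 : Continuous fun f => tensor sigma sigma f f := by fun_prop
  exact (tensor sigma (sigma.prod sigma)).continuous.clm_apply h2

lemma norm_tensorCube (f : Lp ℂ 2 sigma) : ‖tensorCube f‖ = ‖f‖ ^ 3 := by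
  rw [tensorCube]
  refine (norm_tensor (μ := sigma) (ν := sigma.prod sigma) _ _).trans ?_
  rw [norm_tensor]
  ring

lemma coeFn_tensorCube (f : Lp ℂ 2 sigma) :
    tensorCube f =ᵐ[sigmaCube] fun y => f y.1 * (f y.2.1 * f y.2.2) := by
  filter_upwards [coeFn_tensor (μ := sigma) (ν := sigma.prod sigma) f (tensor sigma sigma f f),
    ae_prod_snd (μ := sigma) (coeFn_tensor (μ := sigma) (ν := sigma) f f)] with z h1 h2
  rw [← h2]
  exact h1

/-! ### Composition with the momentum map on `L²`. -/

/-- The momentum plane with its Euclidean structure. -/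
abbrev Plane : Type := WithLp 2 (ℝ × ℝ)

/-- The sum of three points of the hyperbola in the frequency scale of `𝓕`. -/
noncomputable def frequency (y : ℝ × ℝ × ℝ) : Plane :=
  (2 * Real.pi)⁻¹ • WithLp.toLp 2 (momentum y)

lemma continuous_frequency : Continuous frequency := by
  have h2 : Continuous fun y => (WithLp.toLp 2 (momentum y) : Plane) :=
    (WithLp.prod_continuous_toLp 2 ℝ ℝ).comp continuous_momentum
  exact h2.const_smul (2 * Real.pi)⁻¹

lemma lintegral_comp_scaling (h : Plane → ℝ≥0∞) (hh : Measurable h) :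
    ∫⁻ z : ℝ × ℝ, h ((2 * Real.pi)⁻¹ • WithLp.toLp 2 z) =
      ENNReal.ofReal ((2 * Real.pi) ^ 2) * ∫⁻ z, h z := by
  have h1 := (WithLp.volume_preserving_toLp ℝ ℝ).lintegral_comp
    (f := fun z => h ((2 * Real.pi)⁻¹ • z)) (by fun_prop)
  rw [h1, ← lintegral_map hh (measurable_const_smul _),
    Measure.map_addHaar_smul _ (by positivity), lintegral_smul_measure]
  congr 2
  have : Module.finrank ℝ Plane = 2 := by
    rw [(WithLp.linearEquiv 2 ℝ (ℝ × ℝ)).finrank_eq]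
    simp
  rw [this, abs_of_pos (by positivity), inv_pow, inv_inv]

/-- The square of the norm of the composition with `frequency`. -/
noncomputable def normBound : ℝ := 2 * Real.pi / √3 * (2 * Real.pi) ^ 2

lemma normBound_pos : 0 < normBound := by unfold normBound; positivity

lemma ofReal_normBound : ENNReal.ofReal normBound =
    ENNReal.ofReal (2 * Real.pi / √3) * ENNReal.ofReal ((2 * Real.pi) ^ 2) :=
  ENNReal.ofReal_mul (by positivity)

lemma lintegral_frequency_le {h : Plane → ℝ≥0∞} (hh : Measurable h) :
    ∫⁻ y, h (frequency y) ∂sigmaCube ≤ ENNReal.ofReal normBound * ∫⁻ z, h z := by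
  rw [ofReal_normBound, mul_assoc, ← lintegral_comp_scaling h hh]
  exact lintegral_momentum_le (h := fun z => h ((2 * Real.pi)⁻¹ • WithLp.toLp 2 z))
    (by fun_prop)

lemma lintegral_frequency_lt {h : Plane → ℝ≥0∞} (hh : Measurable h)
    (h0 : ∫⁻ z, h z ≠ 0) (hfin : ∫⁻ z, h z ≠ ∞) :
    ∫⁻ y, h (frequency y) ∂sigmaCube < ENNReal.ofReal normBound * ∫⁻ z, h z := by
  have hs := lintegral_comp_scaling h hh
  rw [ofReal_normBound, mul_assoc, ← hs]
  refine lintegral_momentum_lt (h := fun z => h ((2 * Real.pi)⁻¹ • WithLp.toLp 2 z))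
    (by fun_prop) ?_ ?_
  · rw [hs]; exact mul_ne_zero (by simp) h0
  · rw [hs]; exact ENNReal.mul_ne_top ENNReal.ofReal_ne_top hfin

/-- The density bound applied to indicators shows that preimages of null sets are null, so
composition with `frequency` respects almost-everywhere classes. -/
lemma quasiMeasurePreserving_frequency :
    Measure.QuasiMeasurePreserving frequency sigmaCube volume := by
  refine ⟨continuous_frequency.measurable, Measure.AbsolutelyContinuous.mk fun s hs h0 => ?_⟩
  rw [Measure.map_apply continuous_frequency.measurable hs,
    ← lintegral_indicator_one (continuous_frequency.measurable hs)]
  refine le_antisymm ?_ zero_le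
  refine (lintegral_frequency_le (h := s.indicator 1) (measurable_one.indicator hs)).trans ?_
  rw [lintegral_indicator_one hs, h0, mul_zero]

lemma enorm_sq_eq_lintegral {α : Type*} [MeasurableSpace α] {μ : Measure α} (f : α → ℂ) :
    eLpNorm f 2 μ ^ 2 = ∫⁻ x, ‖f x‖ₑ ^ 2 ∂μ := by
  rw [eLpNorm_eq_lintegral_rpow_enorm_toReal two_ne_zero ENNReal.ofNat_ne_top,
    ← ENNReal.rpow_natCast, ← ENNReal.rpow_mul]
  simp

lemma enorm_comp_frequency_sq_le (f : Lp ℂ 2 (volume : Measure Plane)) :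
    eLpNorm (f ∘ frequency) 2 sigmaCube ^ 2 ≤ ENNReal.ofReal normBound * ‖f‖ₑ ^ 2 := by
  rw [enorm_sq_eq_lintegral, Lp.enorm_def, enorm_sq_eq_lintegral]
  exact lintegral_frequency_le (h := fun z => ‖f z‖ₑ ^ 2)
    ((Lp.stronglyMeasurable f).measurable.enorm.pow_const 2)

lemma memLp_comp_frequency (f : Lp ℂ 2 (volume : Measure Plane)) :
    MemLp (f ∘ frequency) 2 sigmaCube := by
  refine ⟨((Lp.stronglyMeasurable f).comp_measurable
    continuous_frequency.measurable).aestronglyMeasurable, ?_⟩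
  have h : eLpNorm (f ∘ frequency) 2 sigmaCube ^ 2 < ∞ :=
    (enorm_comp_frequency_sq_le f).trans_lt
      (ENNReal.mul_lt_top ENNReal.ofReal_lt_top (ENNReal.pow_lt_top enorm_lt_top))
  simpa using h

/-- Composition with `frequency` as a linear map on `L²`. -/
noncomputable def compFrequencyₗ :
    Lp ℂ 2 (volume : Measure Plane) →ₗ[ℂ] Lp ℂ 2 sigmaCube where
  toFun f := (memLp_comp_frequency f).toLp _
  map_add' f g := by
    rw [← MemLp.toLp_add]
    exact MemLp.toLp_congr _ _ (quasiMeasurePreserving_frequency.ae (Lp.coeFn_add f g))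
  map_smul' c f := by
    rw [RingHom.id_apply, ← MemLp.toLp_const_smul]
    exact MemLp.toLp_congr _ _ (quasiMeasurePreserving_frequency.ae (Lp.coeFn_smul c f))

lemma coeFn_compFrequencyₗ (f : Lp ℂ 2 (volume : Measure Plane)) :
    compFrequencyₗ f =ᵐ[sigmaCube] f ∘ frequency :=
  MemLp.coeFn_toLp (memLp_comp_frequency f)

lemma enorm_compFrequencyₗ (f : Lp ℂ 2 (volume : Measure Plane)) :
    ‖compFrequencyₗ f‖ₑ = eLpNorm (f ∘ frequency) 2 sigmaCube := by
  rw [Lp.enorm_def, eLpNorm_congr_ae (coeFn_compFrequencyₗ f)]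

lemma toReal_normBound_mul_enorm_sq (f : Lp ℂ 2 (volume : Measure Plane)) :
    (ENNReal.ofReal normBound * ‖f‖ₑ ^ 2).toReal = normBound * ‖f‖ ^ 2 := by
  rw [ENNReal.toReal_mul, ENNReal.toReal_pow, toReal_enorm,
    ENNReal.toReal_ofReal normBound_pos.le]

lemma normBound_mul_enorm_sq_ne_top (f : Lp ℂ 2 (volume : Measure Plane)) :
    ENNReal.ofReal normBound * ‖f‖ₑ ^ 2 ≠ ∞ :=
  ENNReal.mul_ne_top ENNReal.ofReal_ne_top (ENNReal.pow_ne_top enorm_ne_top)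

lemma norm_sq_compFrequencyₗ_le (f : Lp ℂ 2 (volume : Measure Plane)) :
    ‖compFrequencyₗ f‖ ^ 2 ≤ normBound * ‖f‖ ^ 2 := by
  rw [← toReal_normBound_mul_enorm_sq, ← toReal_enorm, ← ENNReal.toReal_pow]
  refine ENNReal.toReal_mono (normBound_mul_enorm_sq_ne_top f) ?_
  rw [enorm_compFrequencyₗ]
  exact enorm_comp_frequency_sq_le f

lemma norm_sq_compFrequencyₗ_lt {f : Lp ℂ 2 (volume : Measure Plane)} (hf : f ≠ 0) :
    ‖compFrequencyₗ f‖ ^ 2 < normBound * ‖f‖ ^ 2 := by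
  rw [← toReal_normBound_mul_enorm_sq, ← toReal_enorm, ← ENNReal.toReal_pow]
  have hsq : ‖f‖ₑ ^ 2 = ∫⁻ z, ‖f z‖ₑ ^ 2 := by rw [Lp.enorm_def, enorm_sq_eq_lintegral]
  refine ENNReal.toReal_strict_mono (normBound_mul_enorm_sq_ne_top f) ?_
  rw [enorm_compFrequencyₗ, enorm_sq_eq_lintegral, hsq]
  refine lintegral_frequency_lt (h := fun z => ‖f z‖ₑ ^ 2)
    ((Lp.stronglyMeasurable f).measurable.enorm.pow_const 2) ?_ ?_
  · rw [← hsq]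
    simpa using hf
  · rw [← hsq]
    exact ENNReal.pow_ne_top enorm_ne_top

/-- Composition with `frequency` as a bounded operator on `L²`. -/
noncomputable def compFrequency :
    Lp ℂ 2 (volume : Measure Plane) →L[ℂ] Lp ℂ 2 sigmaCube :=
  compFrequencyₗ.mkContinuous (√normBound) fun f => by
    refine (sq_le_sq₀ (norm_nonneg _) (by positivity)).1 ?_
    rw [mul_pow, Real.sq_sqrt normBound_pos.le]
    exact norm_sq_compFrequencyₗ_le f

/-! ### Fourier restriction and its adjoint. -/

/-- The Fourier transform followed by the composition with `frequency`. -/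
noncomputable def fourierRestriction :
    Lp ℂ 2 (volume : Measure Plane) →L[ℂ] Lp ℂ 2 sigmaCube :=
  compFrequency ∘L (Lp.fourierTransformₗᵢ Plane ℂ).toContinuousLinearEquiv.toContinuousLinearMap

lemma fourierRestriction_apply (f : Lp ℂ 2 (volume : Measure Plane)) :
    fourierRestriction f = compFrequencyₗ (𝓕 f) := rfl

lemma norm_sq_fourierRestriction_lt {f : Lp ℂ 2 (volume : Measure Plane)} (hf : f ≠ 0) :
    ‖fourierRestriction f‖ ^ 2 < normBound * ‖f‖ ^ 2 := by
  rw [fourierRestriction_apply, ← Lp.norm_fourier_eq f]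
  refine norm_sq_compFrequencyₗ_lt ?_
  rw [← norm_ne_zero_iff, Lp.norm_fourier_eq f]
  exact norm_ne_zero_iff.2 hf

/-- The adjoint of an operator that does not attain the bound `√c` does not attain it either. -/
lemma norm_sq_adjoint_lt {E F : Type*} [NormedAddCommGroup E] [InnerProductSpace ℂ E]
    [CompleteSpace E] [NormedAddCommGroup F] [InnerProductSpace ℂ F] [CompleteSpace F]
    {A : E →L[ℂ] F} {c : ℝ} (hc : 0 < c) (hA : ∀ x, x ≠ 0 → ‖A x‖ ^ 2 < c * ‖x‖ ^ 2) {y : F}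
    (hy : y ≠ 0) : ‖A.adjoint y‖ ^ 2 < c * ‖y‖ ^ 2 := by
  by_cases hx : A.adjoint y = 0
  · rw [hx, norm_zero]
    have := norm_pos_iff.2 hy
    rw [zero_pow two_ne_zero]
    positivity
  -- With `x = A* y`, `‖x‖² = ⟪A x, y⟫`. The strict bound for `A` at this particular `x` then
  -- transfers to `y` after cancelling `‖x‖²`.
  · have h1 : ‖A.adjoint y‖ ^ 2 ≤ ‖A (A.adjoint y)‖ * ‖y‖ := by
      have h2 : ⟪A.adjoint y, A.adjoint y⟫_ℂ = ⟪A (A.adjoint y), y⟫_ℂ :=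
        ContinuousLinearMap.adjoint_inner_right A _ _
      have h3 := norm_inner_le_norm (𝕜 := ℂ) (A (A.adjoint y)) y
      rw [← h2, inner_self_eq_norm_sq_to_K] at h3
      simpa using h3
    have h4 := hA _ hx
    have hxp := norm_pos_iff.2 hx
    have hyp := norm_pos_iff.2 hy
    have h5 : (‖A.adjoint y‖ ^ 2) ^ 2 < ‖A.adjoint y‖ ^ 2 * (c * ‖y‖ ^ 2) := by
      calc (‖A.adjoint y‖ ^ 2) ^ 2 ≤ (‖A (A.adjoint y)‖ * ‖y‖) ^ 2 := by gcongr
        _ = ‖A (A.adjoint y)‖ ^ 2 * ‖y‖ ^ 2 := by ring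
        _ < c * ‖A.adjoint y‖ ^ 2 * ‖y‖ ^ 2 := by gcongr
        _ = _ := by ring
    rw [sq (‖A.adjoint y‖ ^ 2)] at h5
    exact lt_of_mul_lt_mul_left h5 (by positivity)

lemma norm_sq_adjoint_fourierRestriction_lt {G : Lp ℂ 2 sigmaCube} (hG : G ≠ 0) :
    ‖fourierRestriction.adjoint G‖ ^ 2 < normBound * ‖G‖ ^ 2 :=
  norm_sq_adjoint_lt normBound_pos (fun _ h => norm_sq_fourierRestriction_lt h) hG

/-- The inverse Fourier transform of the image under `frequency` of the measure with density `G`. -/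
noncomputable def waveIntegral (G : ℝ × ℝ × ℝ → ℂ) (z : Plane) : ℂ :=
  ∫ y, Complex.exp (Complex.I * ((2 * Real.pi * ⟪z, frequency y⟫_ℝ : ℝ) : ℂ)) * G y ∂sigmaCube

lemma norm_exp_I_mul (x : ℝ) : ‖Complex.exp (Complex.I * (x : ℂ))‖ = 1 := by
  rw [mul_comm, Complex.norm_exp_ofReal_mul_I]

lemma continuous_phase : Continuous fun p : Plane × (ℝ × ℝ × ℝ) =>
    Complex.exp (Complex.I * ((2 * Real.pi * ⟪p.1, frequency p.2⟫_ℝ : ℝ) : ℂ)) := by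
  have := continuous_frequency
  fun_prop

lemma continuous_waveIntegral {G : ℝ × ℝ × ℝ → ℂ} (hG : Integrable G sigmaCube) :
    Continuous (waveIntegral G) := by
  refine continuous_of_dominated (bound := fun y => ‖G y‖) (fun z => ?_) (fun z => ?_) hG.norm ?_
  · exact ((continuous_phase.comp (Continuous.prodMk_right z)).aestronglyMeasurable).mul hG.1
  · refine Eventually.of_forall fun y => ?_
    rw [norm_mul, norm_exp_I_mul, one_mul]
  · refine Eventually.of_forall fun y => ?_
    exact (continuous_phase.comp (Continuous.prodMk_left y)).mul continuous_const

instance : SFinite sigmaCube := by unfold sigmaCube; infer_instance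

lemma coeFn_fourierRestriction_toLp (φ : SchwartzMap Plane ℂ) :
    ∀ᵐ y ∂sigmaCube, fourierRestriction (φ.toLp 2) y = (𝓕 φ : SchwartzMap Plane ℂ) (frequency y) := by
  have hae : ∀ᵐ x, ((𝓕 φ : SchwartzMap Plane ℂ).toLp 2) x = (𝓕 φ : SchwartzMap Plane ℂ) x :=
    SchwartzMap.coeFn_toLp _ _ _
  rw [fourierRestriction_apply, SchwartzMap.toLp_fourier_eq]
  filter_upwards [coeFn_compFrequencyₗ ((𝓕 φ : SchwartzMap Plane ℂ).toLp 2),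
    quasiMeasurePreserving_frequency.ae hae] with y hy hy'
  rw [hy, Function.comp_apply, hy']

lemma conj_fourier_eq (φ : SchwartzMap Plane ℂ) {g : Plane → ℝ} (hφ : ∀ z, φ z = (g z : ℂ))
    (w : Plane) : (starRingEnd ℂ) ((𝓕 φ : SchwartzMap Plane ℂ) w) = ∫ z,
      (g z : ℂ) * Complex.exp (Complex.I * ((2 * Real.pi * ⟪z, w⟫_ℝ : ℝ) : ℂ)) := by
  rw [SchwartzMap.fourier_coe, Real.fourier_eq, ← integral_conj]
  refine integral_congr_ae (Eventually.of_forall fun z => ?_)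
  simp only [hφ, Circle.smul_def, Real.fourierChar_apply, smul_eq_mul, map_mul,
    Complex.conj_ofReal, ← Complex.exp_conj, Complex.conj_I]
  rw [show ((2 * Real.pi * -⟪z, w⟫_ℝ : ℝ) : ℂ) * -Complex.I =
    Complex.I * ((2 * Real.pi * ⟪z, w⟫_ℝ : ℝ) : ℂ) by push_cast; ring]
  ring

lemma integrable_phase_mul {G : ℝ × ℝ × ℝ → ℂ} (hG : Integrable G sigmaCube) {g : Plane → ℂ}
    (hg : Integrable g) : Integrable (fun p : (ℝ × ℝ × ℝ) × Plane => g p.2 *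
      (Complex.exp (Complex.I * ((2 * Real.pi * ⟪p.2, frequency p.1⟫_ℝ : ℝ) : ℂ)) * G p.1))
      (sigmaCube.prod volume) := by
  refine (hG.mul_prod hg).mono ?_ ?_
  · refine AEStronglyMeasurable.mul ?_ (AEStronglyMeasurable.mul ?_ hG.1.comp_fst)
    · exact hg.1.comp_snd
    · exact (continuous_phase.comp continuous_swap).aestronglyMeasurable
  · refine Eventually.of_forall fun p => ?_
    simp only [norm_mul, norm_exp_I_mul]
    rw [one_mul, mul_comm]

/-- By Fubini, the abstract adjoint acts weakly as the explicit oscillatory integral. Real test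
functions suffice and keep the conjugation confined to the phase. -/
lemma inner_adjoint_fourierRestriction {G : Lp ℂ 2 sigmaCube} (hG : Integrable G sigmaCube)
    (φ : SchwartzMap Plane ℂ) {g : Plane → ℝ} (hφ : ∀ z, φ z = (g z : ℂ)) :
    ⟪φ.toLp 2, fourierRestriction.adjoint G⟫_ℂ = ∫ z, g z • waveIntegral G z := by
  have hgint : Integrable (fun z => (g z : ℂ)) (volume : Measure Plane) := by
    simpa only [← hφ] using φ.integrable
  rw [ContinuousLinearMap.adjoint_inner_right, L2.inner_def]
  calc _ = ∫ y, (∫ z, (g z : ℂ) *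
        (Complex.exp (Complex.I * ((2 * Real.pi * ⟪z, frequency y⟫_ℝ : ℝ) : ℂ)) * G y))
          ∂sigmaCube := by
        refine integral_congr_ae ?_
        filter_upwards [coeFn_fourierRestriction_toLp φ] with y hy
        rw [hy, RCLike.inner_apply, conj_fourier_eq φ hφ, ← integral_const_mul]
        refine integral_congr_ae (Eventually.of_forall fun z => ?_)
        simp only
        ring
    _ = _ := by
        rw [integral_integral_swap (integrable_phase_mul hG hgint)]
        refine integral_congr_ae (Eventually.of_forall fun z => ?_)
        simp only [waveIntegral, Complex.real_smul]
        rw [integral_const_mul]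

lemma ae_eq_of_inner_toLp (F : Lp ℂ 2 (volume : Measure Plane)) {u : Plane → ℂ}
    (hu : LocallyIntegrable u)
    (h : ∀ (φ : SchwartzMap Plane ℂ) (g : Plane → ℝ), (∀ z, φ z = (g z : ℂ)) →
      ⟪φ.toLp 2, F⟫_ℂ = ∫ z, g z • u z) :
    F =ᵐ[volume] u := by
  refine ae_eq_of_integral_contDiff_smul_eq
    ((Lp.memLp F).locallyIntegrable one_le_two) hu fun g hg hsupp => ?_
  have hgc : HasCompactSupport fun z => (g z : ℂ) := hsupp.comp_left (g := Complex.ofReal) rfl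
  have hgd : ContDiff ℝ (⊤ : ℕ∞) fun z => (g z : ℂ) := Complex.ofRealCLM.contDiff.comp hg
  obtain ⟨φ, hφ⟩ : ∃ φ : SchwartzMap Plane ℂ, ∀ z, φ z = (g z : ℂ) :=
    ⟨hgc.toSchwartzMap hgd, fun z => rfl⟩
  rw [← h φ g hφ, L2.inner_def]
  refine integral_congr_ae ?_
  filter_upwards [φ.coeFn_toLp 2] with z hz
  rw [hz, hφ, RCLike.inner_apply, Complex.conj_ofReal, Complex.real_smul, mul_comm]

lemma adjoint_fourierRestriction_ae_eq {G : Lp ℂ 2 sigmaCube} (hG : Integrable G sigmaCube) :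
    fourierRestriction.adjoint G =ᵐ[volume] waveIntegral G :=
  ae_eq_of_inner_toLp _ (continuous_waveIntegral hG).locallyIntegrable
    fun φ _ hφ => inner_adjoint_fourierRestriction hG φ hφ

/-! ### The extension integral and its cube. -/

/-- Through this domination `sigma` inherits local finiteness and temperate growth, hence the
density of Schwartz functions in `L²`. It also bounds the norms of the Gaussians in the lower bound.
-/
lemma sigma_le_volume : sigma ≤ volume := by
  refine Measure.le_iff.2 fun s hs => ?_
  rw [sigma, withDensity_apply _ hs, ← setLIntegral_one]
  refine lintegral_mono fun y => ?_
  rw [← ENNReal.ofReal_one]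
  refine ENNReal.ofReal_le_ofReal ?_
  rw [div_le_one (by positivity)]
  exact Real.one_le_sqrt.2 (by nlinarith [sq_nonneg y])

instance : IsFiniteMeasureOnCompacts sigma :=
  ⟨fun _ hK => (sigma_le_volume _).trans_lt hK.measure_lt_top⟩

instance : sigma.HasTemperateGrowth := by
  obtain ⟨n, hn⟩ := (inferInstance : (volume : Measure ℝ).HasTemperateGrowth)
  exact ⟨n, hn.mono_measure sigma_le_volume⟩

/-- The phase of the extension integral. -/
noncomputable def wavePhase (z : ℝ × ℝ) (y : ℝ) : ℂ :=
  Complex.exp (Complex.I * ((z.1 * y + z.2 * √(1 + y ^ 2) : ℝ) : ℂ))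

lemma norm_wavePhase (z : ℝ × ℝ) (y : ℝ) : ‖wavePhase z y‖ = 1 := norm_exp_I_mul _

lemma continuous_wavePhase : Continuous fun p : (ℝ × ℝ) × ℝ => wavePhase p.1 p.2 := by
  unfold wavePhase; fun_prop

lemma extensionIntegral_eq (f : ℝ → ℂ) (z : ℝ × ℝ) :
    extensionIntegral f z = ∫ y, wavePhase z y * f y ∂sigma := by
  rw [sigma, integral_withDensity_eq_integral_toReal_smul measurable_density
    (Eventually.of_forall fun _ => ENNReal.ofReal_lt_top), extensionIntegral]
  refine integral_congr_ae (Eventually.of_forall fun y => ?_)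
  simp only [wavePhase]
  rw [ENNReal.toReal_ofReal (one_div_sqrt_nonneg y), Complex.real_smul, ← Complex.exp_add]
  push_cast
  rw [mul_add]
  ring

lemma integrable_wavePhase_mul {f : ℝ → ℂ} (hf : Integrable f sigma) (z : ℝ × ℝ) :
    Integrable (fun y => wavePhase z y * f y) sigma :=
  hf.mono ((continuous_wavePhase.comp (Continuous.prodMk_right z)).aestronglyMeasurable.mul hf.1)
    (Eventually.of_forall fun y => by rw [norm_mul, norm_wavePhase, one_mul])

lemma continuous_extensionIntegral {f : ℝ → ℂ} (hf : Integrable f sigma) :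
    Continuous (extensionIntegral f) := by
  rw [funext (extensionIntegral_eq f)]
  refine continuous_of_dominated (bound := fun y => ‖f y‖)
    (fun z => (integrable_wavePhase_mul hf z).1) (fun z => ?_) hf.norm ?_
  · exact Eventually.of_forall fun y => by rw [norm_mul, norm_wavePhase, one_mul]
  · exact Eventually.of_forall fun y =>
      (continuous_wavePhase.comp (Continuous.prodMk_left y)).mul continuous_const

lemma inner_toLp_frequency (z : ℝ × ℝ) (y : ℝ × ℝ × ℝ) :
    2 * Real.pi * ⟪(WithLp.toLp 2 z : Plane), frequency y⟫_ℝ =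
      z.1 * (momentum y).1 + z.2 * (momentum y).2 := by
  rw [frequency, inner_smul_right, ← mul_assoc, mul_inv_cancel₀ (by positivity), one_mul,
    WithLp.prod_inner_apply]
  simp [mul_comm]

/-- The phase is additive in the three points, so the exponential factors and the triple integral
splits. -/
lemma waveIntegral_cube (f : ℝ → ℂ) (z : ℝ × ℝ) :
    waveIntegral (fun y => f y.1 * (f y.2.1 * f y.2.2)) (WithLp.toLp 2 z) =
      extensionIntegral f z ^ 3 := by
  set w : ℝ → ℂ := fun y => wavePhase z y * f y with hw
  have h1 : ∀ y : ℝ × ℝ × ℝ,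
      Complex.exp (Complex.I *
        ((2 * Real.pi * ⟪(WithLp.toLp 2 z : Plane), frequency y⟫_ℝ : ℝ) : ℂ)) *
        (f y.1 * (f y.2.1 * f y.2.2)) = w y.1 * (w y.2.1 * w y.2.2) := fun y => by
    have h2 : Complex.exp (Complex.I *
        ((2 * Real.pi * ⟪(WithLp.toLp 2 z : Plane), frequency y⟫_ℝ : ℝ) : ℂ)) =
        wavePhase z y.1 * (wavePhase z y.2.1 * wavePhase z y.2.2) := by
      rw [inner_toLp_frequency, wavePhase, wavePhase, wavePhase, ← Complex.exp_add,
        ← Complex.exp_add]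
      congr 1
      simp only [momentum]
      push_cast
      ring
    rw [h2]
    simp only [hw]
    ring
  rw [waveIntegral, integral_congr_ae (Eventually.of_forall h1), sigmaCube,
    integral_prod_mul w (fun y : ℝ × ℝ => w y.1 * w y.2), integral_prod_mul w w,
    ← extensionIntegral_eq]
  ring

/-- The element of `L²` given by a Schwartz function. -/
noncomputable def schwartzToLp : SchwartzMap ℝ ℂ →ₗ[ℂ] Lp ℂ 2 sigma :=
  (SchwartzMap.toLpCLM ℂ ℂ 2 sigma).toLinearMap

lemma coeFn_schwartzToLp (φ : SchwartzMap ℝ ℂ) : schwartzToLp φ =ᵐ[sigma] φ :=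
  φ.coeFn_toLp 2 sigma

lemma denseRange_schwartzToLp : DenseRange schwartzToLp :=
  SchwartzMap.denseRange_toLpCLM (E := ℝ) (F := ℂ) (p := 2) (μ := sigma) ENNReal.ofNat_ne_top

lemma coeFn_tensorCube_schwartzToLp (φ : SchwartzMap ℝ ℂ) :
    tensorCube (schwartzToLp φ) =ᵐ[sigmaCube] fun y => φ y.1 * (φ y.2.1 * φ y.2.2) := by
  have h : ∀ᵐ y ∂sigma, schwartzToLp φ y = φ y := coeFn_schwartzToLp φ
  filter_upwards [coeFn_tensorCube (schwartzToLp φ), ae_prod_fst (ν := sigma.prod sigma) h,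
    ae_prod_snd (μ := sigma) (ae_prod_fst (ν := sigma) h),
    ae_prod_snd (μ := sigma) (ae_prod_snd (μ := sigma) h)] with y h0 h1 h2 h3
  rw [h0, h1, h2, h3]

lemma integrable_cube {f : ℝ → ℂ} (hf : Integrable f sigma) :
    Integrable (fun y : ℝ × ℝ × ℝ => f y.1 * (f y.2.1 * f y.2.2)) sigmaCube :=
  hf.mul_prod (hf.mul_prod hf)

lemma waveIntegral_congr {G G' : ℝ × ℝ × ℝ → ℂ} (h : G =ᵐ[sigmaCube] G') :
    waveIntegral G = waveIntegral G' := by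
  funext z
  refine integral_congr_ae ?_
  filter_upwards [h] with y hy
  rw [hy]

/-- The cube of the extension integral is the adjoint of `fourierRestriction` at `f ⊗ f ⊗ f`. -/
lemma adjoint_tensorCube_ae_eq (φ : SchwartzMap ℝ ℂ) :
    ∀ᵐ z : ℝ × ℝ, fourierRestriction.adjoint (tensorCube (schwartzToLp φ)) (WithLp.toLp 2 z) =
      extensionIntegral φ z ^ 3 := by
  have hφ : Integrable φ sigma := φ.integrable
  have hcube := coeFn_tensorCube_schwartzToLp φ
  have h := adjoint_fourierRestriction_ae_eq ((integrable_cube hφ).congr hcube.symm)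
  rw [waveIntegral_congr hcube] at h
  have h2 := (WithLp.volume_preserving_toLp ℝ ℝ).quasiMeasurePreserving.ae h
  filter_upwards [h2] with z hz
  rw [hz, waveIntegral_cube]

lemma lintegral_extensionIntegral_pow (φ : SchwartzMap ℝ ℂ) :
    ∫⁻ z, ‖extensionIntegral φ z‖ₑ ^ 6 =
      ‖fourierRestriction.adjoint (tensorCube (schwartzToLp φ))‖ₑ ^ 2 := by
  set H := fourierRestriction.adjoint (tensorCube (schwartzToLp φ)) with hH
  rw [Lp.enorm_def, enorm_sq_eq_lintegral, ← (WithLp.volume_preserving_toLp ℝ ℝ).lintegral_comp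
    ((Lp.stronglyMeasurable H).measurable.enorm.pow_const 2)]
  refine lintegral_congr_ae ?_
  filter_upwards [adjoint_tensorCube_ae_eq φ] with z hz
  rw [hz, enorm_pow, ← pow_mul]

lemma eLpNorm_six_pow {α : Type*} [MeasurableSpace α] {μ : Measure α} (f : α → ℂ) :
    eLpNorm f 6 μ ^ 6 = ∫⁻ x, ‖f x‖ₑ ^ 6 ∂μ := by
  rw [eLpNorm_eq_lintegral_rpow_enorm_toReal (by simp) ENNReal.ofNat_ne_top,
    ← ENNReal.rpow_natCast, ← ENNReal.rpow_mul]
  simp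

lemma memLp_extensionIntegral (φ : SchwartzMap ℝ ℂ) :
    MemLp (extensionIntegral φ) 6 volume := by
  refine ⟨(continuous_extensionIntegral φ.integrable).aestronglyMeasurable, ?_⟩
  have h : eLpNorm (extensionIntegral φ) 6 volume ^ 6 < ∞ := by
    rw [eLpNorm_six_pow, lintegral_extensionIntegral_pow]
    exact ENNReal.pow_lt_top enorm_lt_top
  simpa using h

lemma extensionIntegral_add (φ ψ : SchwartzMap ℝ ℂ) :
    extensionIntegral (φ + ψ : SchwartzMap ℝ ℂ) = extensionIntegral φ + extensionIntegral ψ := by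
  funext z
  simp only [extensionIntegral_eq, Pi.add_apply, _root_.add_apply, mul_add]
  exact integral_add (integrable_wavePhase_mul φ.integrable z)
    (integrable_wavePhase_mul ψ.integrable z)

lemma extensionIntegral_smul (c : ℂ) (φ : SchwartzMap ℝ ℂ) :
    extensionIntegral (c • φ : SchwartzMap ℝ ℂ) = c • extensionIntegral φ := by
  funext z
  simp only [extensionIntegral_eq, Pi.smul_apply, _root_.smul_apply, smul_eq_mul,
    mul_left_comm _ c]
  exact integral_const_mul _ _

/-! ### The operator `L² → L⁶` and the strict upper bound. -/

/-- The extension integral as a linear map from Schwartz functions to `L⁶`. -/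
noncomputable def schwartzExtension :
    SchwartzMap ℝ ℂ →ₗ[ℂ] Lp ℂ 6 (volume : Measure (ℝ × ℝ)) where
  toFun φ := (memLp_extensionIntegral φ).toLp _
  map_add' φ ψ := by
    rw [← MemLp.toLp_add]
    exact MemLp.toLp_congr _ _ (by rw [extensionIntegral_add])
  map_smul' c φ := by
    rw [RingHom.id_apply, ← MemLp.toLp_const_smul]
    exact MemLp.toLp_congr _ _ (by rw [extensionIntegral_smul])

lemma coeFn_schwartzExtension (φ : SchwartzMap ℝ ℂ) :
    schwartzExtension φ =ᵐ[volume] extensionIntegral φ :=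
  MemLp.coeFn_toLp (memLp_extensionIntegral φ)

lemma enorm_schwartzExtension_pow (φ : SchwartzMap ℝ ℂ) :
    ‖schwartzExtension φ‖ₑ ^ 6 = ∫⁻ z, ‖extensionIntegral φ z‖ₑ ^ 6 := by
  rw [Lp.enorm_def, eLpNorm_congr_ae (coeFn_schwartzExtension φ), eLpNorm_six_pow]

lemma norm_schwartzExtension_pow (φ : SchwartzMap ℝ ℂ) :
    ‖schwartzExtension φ‖ ^ 6 =
      ‖fourierRestriction.adjoint (tensorCube (schwartzToLp φ))‖ ^ 2 := by
  have h := (enorm_schwartzExtension_pow φ).trans (lintegral_extensionIntegral_pow φ)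
  simpa using congrArg ENNReal.toReal h

/-- The sharp constant. -/
noncomputable def sharpConstant : ℝ := (3 : ℝ) ^ (-(1 / 12) : ℝ) * (2 * Real.pi) ^ (1 / 2 : ℝ)

lemma sharpConstant_pos : 0 < sharpConstant := by unfold sharpConstant; positivity

lemma sharpConstant_pow : sharpConstant ^ 6 = normBound := by
  rw [sharpConstant, normBound, mul_pow, ← Real.rpow_natCast, ← Real.rpow_natCast,
    ← Real.rpow_mul (by norm_num), ← Real.rpow_mul (by positivity), Real.sqrt_eq_rpow]
  have h1 : (-(1 / 12) : ℝ) * (6 : ℕ) = -(1 / 2) := by norm_num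
  have h2 : (1 / 2 : ℝ) * (6 : ℕ) = (3 : ℕ) := by norm_num
  rw [h1, h2, Real.rpow_natCast, Real.rpow_neg (by norm_num)]
  field_simp

lemma norm_sq_adjoint_tensorCube_lt {f : Lp ℂ 2 sigma} (hf : f ≠ 0) :
    ‖fourierRestriction.adjoint (tensorCube f)‖ ^ 2 < (sharpConstant * ‖f‖) ^ 6 := by
  have hG : tensorCube f ≠ 0 := by
    rw [← norm_ne_zero_iff, norm_tensorCube]
    exact pow_ne_zero _ (norm_ne_zero_iff.2 hf)
  refine (norm_sq_adjoint_fourierRestriction_lt hG).trans_eq ?_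
  rw [norm_tensorCube, mul_pow, sharpConstant_pow]
  ring

lemma norm_schwartzExtension_le (φ : SchwartzMap ℝ ℂ) :
    ‖schwartzExtension φ‖ ≤ sharpConstant * ‖schwartzToLp φ‖ := by
  have hc := sharpConstant_pos
  by_cases h : schwartzToLp φ = 0
  · have h0 : ‖schwartzExtension φ‖ ^ 6 = 0 := by
      have : tensorCube 0 = 0 := by rw [← norm_eq_zero, norm_tensorCube]; simp
      rw [norm_schwartzExtension_pow, h, this]
      simp
    rw [pow_eq_zero_iff (by norm_num)] at h0
    rw [h0]
    positivity
  · refine le_of_lt (lt_of_pow_lt_pow_left₀ 6 (by positivity) ?_)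
    rw [norm_schwartzExtension_pow]
    exact norm_sq_adjoint_tensorCube_lt h

/-- The Fourier extension operator `L² → L⁶`. -/
noncomputable def extensionL6 : Lp ℂ 2 sigma →L[ℂ] Lp ℂ 6 (volume : Measure (ℝ × ℝ)) :=
  schwartzExtension.extendOfNorm schwartzToLp

lemma extensionL6_schwartzToLp (φ : SchwartzMap ℝ ℂ) :
    extensionL6 (schwartzToLp φ) = schwartzExtension φ :=
  LinearMap.extendOfNorm_eq denseRange_schwartzToLp ⟨_, norm_schwartzExtension_le⟩ φ

lemma isExtensionOperator_extensionL6 : IsExtensionOperator 6 extensionL6 := by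
  intro φ f hf
  have : f = schwartzToLp φ := Lp.ext (hf.trans (coeFn_schwartzToLp φ).symm)
  rw [this, extensionL6_schwartzToLp]
  exact coeFn_schwartzExtension φ

lemma IsExtensionOperator.eq_extensionL6
    {T : Lp ℂ 2 sigma →L[ℂ] Lp ℂ 6 (volume : Measure (ℝ × ℝ))} (hT : IsExtensionOperator 6 T) :
    T = extensionL6 := by
  refine ContinuousLinearMap.coeFn_injective
    (denseRange_schwartzToLp.equalizer T.continuous extensionL6.continuous (funext fun φ => ?_))
  have hφ := coeFn_schwartzToLp φ
  exact Lp.ext ((hT φ _ hφ).trans (isExtensionOperator_extensionL6 φ _ hφ).symm)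

lemma extensionOperator_eq : extensionOperator 6 = extensionL6 := by
  have h : ∃ T, IsExtensionOperator 6 T := ⟨_, isExtensionOperator_extensionL6⟩
  rw [extensionOperator, dif_pos h]
  exact h.choose_spec.eq_extensionL6

/-- Strict inequalities do not survive limits. It is this identity that is extended from Schwartz
functions by continuity, so that the strict bound applies directly to every nonzero `f`. -/
lemma norm_extensionL6_pow (f : Lp ℂ 2 sigma) :
    ‖extensionL6 f‖ ^ 6 = ‖fourierRestriction.adjoint (tensorCube f)‖ ^ 2 := by
  have hc := continuous_tensorCube
  have h := denseRange_schwartzToLp.equalizer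
    (g := fun f : Lp ℂ 2 sigma => ‖extensionL6 f‖ ^ 6)
    (h := fun f => ‖fourierRestriction.adjoint (tensorCube f)‖ ^ 2) (by fun_prop) (by fun_prop)
    (funext fun φ => by
      simp only [Function.comp_apply]
      rw [extensionL6_schwartzToLp, norm_schwartzExtension_pow])
  exact congrFun h f

theorem norm_extensionL6_lt {f : Lp ℂ 2 sigma} (hf : f ≠ 0) :
    ‖extensionL6 f‖ < sharpConstant * ‖f‖ := by
  have hc := sharpConstant_pos
  refine lt_of_pow_lt_pow_left₀ 6 (by positivity) ?_
  rw [norm_extensionL6_pow]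
  exact norm_sq_adjoint_tensorCube_lt hf

theorem enorm_extensionL6_lt {f : Lp ℂ 2 sigma} (hf : f ≠ 0) :
    ‖extensionL6 f‖ₑ < ENNReal.ofReal sharpConstant * ‖f‖ₑ := by
  rw [← ofReal_norm, ← ofReal_norm, ← ENNReal.ofReal_mul sharpConstant_pos.le]
  refine (ENNReal.ofReal_lt_ofReal_iff ?_).2 (norm_extensionL6_lt hf)
  exact mul_pos sharpConstant_pos (norm_pos_iff.2 hf)

lemma optimalConstant_le : optimalConstant 6 ≤ ENNReal.ofReal sharpConstant := by
  refine iSup₂_le fun f hf => ENNReal.div_le_of_le_mul ?_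
  rw [extensionOperator_eq]
  exact (enorm_extensionL6_lt hf).le

lemma enorm_extensionL6_le_optimalConstant (f : Lp ℂ 2 sigma) :
    ‖extensionL6 f‖ₑ ≤ optimalConstant 6 * ‖f‖ₑ := by
  by_cases hf : f = 0
  · simp [hf]
  · rw [← extensionOperator_eq]
    refine (ENNReal.div_le_iff (by simpa using hf) enorm_ne_top).1 ?_
    exact le_iSup₂ (f := fun (f : Lp ℂ 2 sigma) (_ : f ≠ 0) => ‖extensionOperator 6 f‖ₑ / ‖f‖ₑ) f hf

/-! ### The lower bound: concentrating Gaussians. -/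

/-- Derivatives of the Gaussian are Hermite polynomials times the Gaussian, so this supplies the
Schwartz decay. -/
lemma exists_polynomial_mul_gaussian_le (p : Polynomial ℝ) :
    ∃ C, ∀ x : ℝ, |p.eval x| * Real.exp (-(x ^ 2 / 2)) ≤ C := by
  induction p using Polynomial.induction_on' with
  | add p q hp hq =>
    obtain ⟨C, hC⟩ := hp
    obtain ⟨D, hD⟩ := hq
    refine ⟨C + D, fun x => ?_⟩
    rw [Polynomial.eval_add]
    refine le_trans ?_ (add_le_add (hC x) (hD x))
    rw [← add_mul]
    gcongr
    exact abs_add_le _ _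
  | monomial n c =>
    refine ⟨|c| * (n.factorial * Real.exp (1 / 2)), fun x => ?_⟩
    rw [Polynomial.eval_monomial, abs_mul, mul_assoc]
    refine mul_le_mul_of_nonneg_left ?_ (abs_nonneg c)
    have h1 := Real.pow_div_factorial_le_exp |x| (abs_nonneg x) n
    rw [div_le_iff₀ (by positivity)] at h1
    -- Completing the square: `|x| - x²/2 ≤ 1/2`.
    have h2 : Real.exp |x| * Real.exp (-(x ^ 2 / 2)) ≤ Real.exp (1 / 2) := by
      rw [← Real.exp_add, Real.exp_le_exp]
      nlinarith [sq_nonneg (|x| - 1), sq_abs x]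
    rw [abs_pow]
    calc |x| ^ n * Real.exp (-(x ^ 2 / 2))
        ≤ Real.exp |x| * n.factorial * Real.exp (-(x ^ 2 / 2)) := by gcongr
      _ = n.factorial * (Real.exp |x| * Real.exp (-(x ^ 2 / 2))) := by ring
      _ ≤ _ := by gcongr

/-- The standard Gaussian as a Schwartz function. -/
noncomputable def gaussianSchwartz : SchwartzMap ℝ ℝ where
  toFun x := Real.exp (-(x ^ 2 / 2))
  smooth' := by fun_prop
  decay' k n := by
    obtain ⟨C, hC⟩ := exists_polynomial_mul_gaussian_le
      (Polynomial.X ^ k * (Polynomial.hermite n).map (Int.castRingHom ℝ))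
    refine ⟨C, fun x => le_trans (le_of_eq ?_) (hC x)⟩
    rw [norm_iteratedFDeriv_eq_norm_iteratedDeriv, iteratedDeriv_eq_iterate,
      Polynomial.deriv_gaussian_eq_hermite_mul_gaussian]
    simp only [Polynomial.eval_mul, Polynomial.eval_pow, Polynomial.eval_X, norm_mul, norm_pow,
      Real.norm_eq_abs, abs_mul, abs_pow, abs_neg, abs_one, one_pow, one_mul, Real.abs_exp,
      Polynomial.eval_map, Polynomial.aeval_def, algebraMap_int_eq]
    ring

lemma exists_scaled_gaussian {a : ℝ} (ha : a ≠ 0) :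
    ∃ φ : SchwartzMap ℝ ℂ, ∀ y, φ y = (Real.exp (-((a * y) ^ 2 / 2)) : ℂ) :=
  ⟨SchwartzMap.compCLMOfContinuousLinearEquiv ℝ
    (ContinuousLinearEquiv.smulLeft (R₁ := ℝ) (M₁ := ℝ) (Units.mk0 a ha))
    (gaussianSchwartz.postcompCLM Complex.ofRealCLM), fun _ => rfl⟩

/-- The extension of a Gaussian of width `ε` in parabolically rescaled coordinates, up to a factor
of modulus one. At `ε = 0` it is a solution of the Schrödinger equation. -/
noncomputable def scaledWave (ε : ℝ) (z : ℝ × ℝ) : ℂ :=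
  ∫ u : ℝ, Complex.exp (Complex.I *
      ((z.1 * u + z.2 * (u ^ 2 / (√(1 + (ε * u) ^ 2) + 1)) : ℝ) : ℂ)) *
    ((Real.exp (-(u ^ 2 / 2)) / √(1 + (ε * u) ^ 2) : ℝ) : ℂ)

lemma integrable_gaussian : Integrable fun u : ℝ => Real.exp (-(u ^ 2 / 2)) := by
  convert! integrable_exp_neg_mul_sq (b := 1 / 2) (by norm_num) using 3
  ring

/-- The rationalized phase `u² / (√(1 + (εu)²) + 1)` has no singularity at `ε = 0`, and the Gaussian
dominates uniformly in all parameters. -/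
lemma continuous_scaledWave : Continuous fun p : ℝ × ℝ × ℝ => scaledWave p.1 p.2 := by
  have h0 : ∀ ε u : ℝ, √(1 + (ε * u) ^ 2) ≠ 0 := fun ε u => by positivity
  have h1 : ∀ ε u : ℝ, √(1 + (ε * u) ^ 2) + 1 ≠ 0 := fun ε u => by positivity
  refine continuous_of_dominated (bound := fun u : ℝ => Real.exp (-(u ^ 2 / 2)))
    (fun p => ?_) (fun p => ?_) integrable_gaussian ?_
  · refine Continuous.aestronglyMeasurable ?_
    have := h0 p.1
    have := h1 p.1
    fun_prop (disch := assumption)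
  · refine Eventually.of_forall fun u => ?_
    rw [norm_mul, norm_exp_I_mul, one_mul, Complex.norm_real, Real.norm_of_nonneg (by positivity)]
    exact div_le_self (Real.exp_pos _).le (Real.one_le_sqrt.2 (by nlinarith [sq_nonneg (p.1 * u)]))
  · refine Eventually.of_forall fun u => ?_
    have h2 := fun p : ℝ × ℝ × ℝ => h0 p.1 u
    have h3 := fun p : ℝ × ℝ × ℝ => h1 p.1 u
    fun_prop (disch := assumption)

/-- Substitute `u = a y` and write `√(1 + y²) = 1 + y² / (√(1 + y²) + 1)`; the constant `1` yields
only a factor of modulus one. -/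
lemma norm_extensionIntegral_scaled_gaussian {a : ℝ} (ha : 0 < a) {φ : ℝ → ℂ}
    (hφ : ∀ y, φ y = (Real.exp (-((a * y) ^ 2 / 2)) : ℂ)) (x t : ℝ) :
    ‖extensionIntegral φ (a * x, a ^ 2 * t)‖ = a⁻¹ * ‖scaledWave a⁻¹ (x, t)‖ := by
  set H : ℝ → ℂ := fun u => Complex.exp (Complex.I *
      ((x * u + t * (u ^ 2 / (√(1 + (a⁻¹ * u) ^ 2) + 1)) : ℝ) : ℂ)) *
    ((Real.exp (-(u ^ 2 / 2)) / √(1 + (a⁻¹ * u) ^ 2) : ℝ) : ℂ) with hH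
  have hpt : ∀ y : ℝ, Complex.exp (Complex.I * ((a * x * y : ℝ) : ℂ)) *
      Complex.exp (Complex.I * ((a ^ 2 * t * √(1 + y ^ 2) : ℝ) : ℂ)) * φ y /
        ((√(1 + y ^ 2) : ℝ) : ℂ) =
      Complex.exp (Complex.I * ((a ^ 2 * t : ℝ) : ℂ)) * H (a * y) := fun y => by
    have hs : √(1 + y ^ 2) ^ 2 = 1 + y ^ 2 := Real.sq_sqrt (by positivity)
    have hs1 : √(1 + y ^ 2) + 1 ≠ 0 := by positivity
    have hphase : a * x * y + a ^ 2 * t * √(1 + y ^ 2) =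
        a ^ 2 * t + (x * (a * y) + t * ((a * y) ^ 2 / (√(1 + y ^ 2) + 1))) := by
      field_simp
      linear_combination (a * t) * hs
    simp only [hH, inv_mul_cancel_left₀ ha.ne', hφ]
    rw [← Complex.exp_add, ← mul_add, ← Complex.ofReal_add, hphase, Complex.ofReal_add, mul_add,
      Complex.exp_add, Complex.ofReal_div]
    ring
  have hint : extensionIntegral φ (a * x, a ^ 2 * t) =
      Complex.exp (Complex.I * ((a ^ 2 * t : ℝ) : ℂ)) * ((a⁻¹ : ℝ) • scaledWave a⁻¹ (x, t)) := by
    rw [extensionIntegral, integral_congr_ae (Eventually.of_forall hpt), integral_const_mul,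
      Measure.integral_comp_mul_left, abs_of_pos (inv_pos.2 ha)]
    rfl
  rw [hint, norm_mul, norm_exp_I_mul, one_mul, norm_smul, Real.norm_of_nonneg (by positivity)]

lemma lintegral_prod_scaling {a b : ℝ} (ha : 0 < a) (hb : 0 < b) {F : ℝ × ℝ → ℝ≥0∞}
    (hF : Measurable F) :
    ∫⁻ z, F z = ENNReal.ofReal (a * b) * ∫⁻ z : ℝ × ℝ, F (a * z.1, b * z.2) := by
  have hF' : Measurable fun z : ℝ × ℝ => F (a * z.1, b * z.2) := by fun_prop
  rw [Measure.volume_eq_prod, lintegral_prod _ hF.aemeasurable, lintegral_prod _ hF'.aemeasurable,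
    lintegral_comp_mul_left ha, ENNReal.ofReal_mul ha.le, mul_assoc]
  congr 1
  rw [← lintegral_const_mul' _ _ ENNReal.ofReal_ne_top]
  exact lintegral_congr fun x => lintegral_comp_mul_left hb fun y => F (a * x, y)

lemma enorm_gaussian_sq (r : ℝ) :
    ‖(Real.exp (-(r ^ 2 / 2)) : ℂ)‖ₑ ^ 2 = ENNReal.ofReal (Real.exp (-1 * r ^ 2)) := by
  rw [← ofReal_norm, Complex.norm_real, Real.norm_of_nonneg (Real.exp_pos _).le,
    ← ENNReal.ofReal_pow (Real.exp_pos _).le, ← Real.exp_nat_mul]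
  congr 2
  push_cast
  ring

lemma lintegral_ofReal_gaussian {c β : ℝ} (hc : 0 ≤ c) (hβ : 0 < β) :
    ∫⁻ x : ℝ, ENNReal.ofReal (c * Real.exp (-β * x ^ 2)) =
      ENNReal.ofReal (c * √(Real.pi / β)) := by
  rw [← integral_gaussian, ← integral_const_mul, ofReal_integral_eq_lintegral_ofReal
    ((integrable_exp_neg_mul_sq hβ).const_mul c)]
  exact Eventually.of_forall fun x => by positivity

/-- The powers of `a` cancel: rescaling `(x, t)` contributes `a³` in total, while the squared norm
of the Gaussian is at most `√π / a` and enters cubed. The bound is therefore uniform in `a`. -/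
lemma lintegral_scaledWave_le {a : ℝ} (ha : 0 < a) :
    ∫⁻ z, ‖scaledWave a⁻¹ z‖ₑ ^ 6 ≤
      optimalConstant 6 ^ 6 * ENNReal.ofReal √Real.pi ^ 3 := by
  obtain ⟨φ, hφ⟩ := exists_scaled_gaussian ha.ne'
  set L := ‖schwartzToLp φ‖ₑ ^ 2 with hL
  have hLle : ENNReal.ofReal a * L ≤ ENNReal.ofReal √Real.pi := by
    have h1 : L ≤ ∫⁻ y, ENNReal.ofReal (Real.exp (-1 * (a * y) ^ 2)) := by
      rw [hL, Lp.enorm_def, eLpNorm_congr_ae (coeFn_schwartzToLp φ), enorm_sq_eq_lintegral]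
      refine (lintegral_mono' sigma_le_volume le_rfl).trans (le_of_eq ?_)
      exact lintegral_congr fun y => by rw [hφ, enorm_gaussian_sq]
    refine (mul_le_mul_right h1 _).trans (le_of_eq ?_)
    rw [← lintegral_comp_mul_left ha fun u => ENNReal.ofReal (Real.exp (-1 * u ^ 2))]
    simpa using lintegral_ofReal_gaussian (c := 1) (β := 1) zero_le_one one_pos
  have hT : ∫⁻ z, ‖extensionIntegral φ z‖ₑ ^ 6 ≤ optimalConstant 6 ^ 6 * L ^ 3 := by
    rw [← enorm_schwartzExtension_pow, ← extensionL6_schwartzToLp, hL, ← pow_mul, ← mul_pow]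
    gcongr
    exact enorm_extensionL6_le_optimalConstant _
  have hscale : ∫⁻ z, ‖scaledWave a⁻¹ z‖ₑ ^ 6 =
      ENNReal.ofReal a ^ 3 * ∫⁻ z, ‖extensionIntegral φ z‖ₑ ^ 6 := by
    have hmeas : Measurable fun z => ‖extensionIntegral φ z‖ₑ ^ 6 :=
      (continuous_extensionIntegral φ.integrable).measurable.enorm.pow_const 6
    rw [lintegral_prod_scaling ha (pow_pos ha 2) hmeas, ← mul_assoc, ← ENNReal.ofReal_pow ha.le,
      ← ENNReal.ofReal_mul (by positivity), ← lintegral_const_mul' _ _ ENNReal.ofReal_ne_top]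
    refine lintegral_congr fun z => ?_
    rw [← ofReal_norm, ← ofReal_norm, norm_extensionIntegral_scaled_gaussian ha hφ,
      ← ENNReal.ofReal_pow (by positivity), ← ENNReal.ofReal_pow (by positivity),
      ← ENNReal.ofReal_mul (by positivity)]
    congr 1
    field_simp
  calc ∫⁻ z, ‖scaledWave a⁻¹ z‖ₑ ^ 6 ≤ ENNReal.ofReal a ^ 3 * (optimalConstant 6 ^ 6 * L ^ 3) := by
        rw [hscale]; gcongr
    _ = optimalConstant 6 ^ 6 * (ENNReal.ofReal a * L) ^ 3 := by ring
    _ ≤ _ := by gcongr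

/-- Only a lower bound for the constant is needed, so Fatou's lemma along `ε → 0` replaces any
domination in `(x, t)`. -/
lemma lintegral_scaledWave_zero_le :
    ∫⁻ z, ‖scaledWave 0 z‖ₑ ^ 6 ≤ optimalConstant 6 ^ 6 * ENNReal.ofReal √Real.pi ^ 3 := by
  set ε : ℕ → ℝ := fun n => 1 / ((n : ℝ) + 1) with hε
  have hε0 : Tendsto ε atTop (𝓝 0) := tendsto_one_div_add_atTop_nhds_zero_nat
  have hlim : ∀ z, liminf (fun n => ‖scaledWave (ε n) z‖ₑ ^ 6) atTop = ‖scaledWave 0 z‖ₑ ^ 6 := by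
    intro z
    have h1 : Continuous fun e => ‖scaledWave e z‖ₑ ^ 6 := by
      have : Continuous fun e => scaledWave e z :=
        continuous_scaledWave.comp (Continuous.prodMk_left z)
      exact (ENNReal.continuous_pow 6).comp this.enorm
    exact ((h1.tendsto 0).comp hε0).liminf_eq
  simp only [← hlim]
  refine (lintegral_liminf_le fun n => ?_).trans ?_
  · have : Continuous fun z => scaledWave (ε n) z :=
      continuous_scaledWave.comp (Continuous.prodMk_right (ε n))
    exact this.measurable.enorm.pow_const 6
  · refine liminf_le_of_le (by isBoundedDefault) fun b hb => ?_
    obtain ⟨n, hn⟩ := hb.exists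
    refine hn.trans ?_
    have := lintegral_scaledWave_le (a := (n : ℝ) + 1) (by positivity)
    simpa only [hε, one_div] using this

/-- At `ε = 0` the phase is `t u² / 2`, which leaves the Fourier integral of a Gaussian with complex
parameter `b = (1 - it)/2`. -/
lemma norm_scaledWave_zero_pow (x t : ℝ) :
    ‖scaledWave 0 (x, t)‖ ^ 6 =
      (2 * Real.pi) ^ 3 / √(1 + t ^ 2) ^ 3 * Real.exp (-(3 / (1 + t ^ 2)) * x ^ 2) := by
  set b : ℂ := (1 - Complex.I * t) / 2 with hb
  have hre : b.re = 1 / 2 := by simp [hb]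
  have him : b.im = -t / 2 := by simp [hb]
  have hnsq : Complex.normSq b = (1 + t ^ 2) / 4 := by
    rw [Complex.normSq_apply, hre, him]; ring
  have hnorm : ‖b‖ = √(1 + t ^ 2) / 2 := by
    rw [Complex.norm_def, hnsq, Real.sqrt_div (by positivity),
      show (4 : ℝ) = 2 ^ 2 by norm_num, Real.sqrt_sq (by norm_num)]
  have hb0 : b ≠ 0 := by
    rw [← norm_ne_zero_iff, hnorm]; positivity
  have hwave : scaledWave 0 (x, t) =
      ((Real.pi : ℂ) / b) ^ (1 / 2 : ℂ) * Complex.exp (-(x : ℂ) ^ 2 / (4 * b)) := by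
    rw [← fourierIntegral_gaussian (by rw [hre]; norm_num) (x : ℂ), scaledWave]
    refine integral_congr_ae (Eventually.of_forall fun u => ?_)
    simp only [zero_mul]
    rw [show √(1 + (0 : ℝ) ^ 2) = 1 by simp, div_one, Complex.ofReal_exp, ← Complex.exp_add,
      ← Complex.exp_add, hb]
    congr 1
    push_cast
    ring
  -- Only even powers of the modulus occur, so squaring removes the complex square root.
  have h1 : ‖((Real.pi : ℂ) / b) ^ (1 / 2 : ℂ)‖ ^ 2 = 2 * Real.pi / √(1 + t ^ 2) := by
    rw [← norm_pow, one_div, Complex.cpow_ofNat_inv_pow, norm_div, hnorm, Complex.norm_real,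
      Real.norm_of_nonneg Real.pi_pos.le]
    field_simp
  have h2 : (-(x : ℂ) ^ 2 / (4 * b)).re = -(x ^ 2 / (2 * (1 + t ^ 2))) := by
    have : -(x : ℂ) ^ 2 / (4 * b) = ((-(x ^ 2 / 4) : ℝ) : ℂ) * b⁻¹ := by
      push_cast; field_simp
    rw [this, Complex.re_ofReal_mul, Complex.inv_re, hre, hnsq]
    field_simp
  rw [hwave, norm_mul, Complex.norm_exp, h2, mul_pow,
    show ‖((Real.pi : ℂ) / b) ^ (1 / 2 : ℂ)‖ ^ 6 =
      (‖((Real.pi : ℂ) / b) ^ (1 / 2 : ℂ)‖ ^ 2) ^ 3 by ring, h1, div_pow, ← Real.exp_nat_mul]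
  congr 2
  push_cast
  field_simp
  ring

lemma lintegral_scaledWave_zero :
    ∫⁻ z, ‖scaledWave 0 z‖ₑ ^ 6 =
      ENNReal.ofReal ((2 * Real.pi) ^ 3 * √(Real.pi / 3) * Real.pi) := by
  have hmeas : Measurable fun z => ‖scaledWave 0 z‖ₑ ^ 6 := by
    have : Continuous fun z => scaledWave 0 z :=
      continuous_scaledWave.comp (Continuous.prodMk_right 0)
    exact this.measurable.enorm.pow_const 6
  rw [Measure.volume_eq_prod, lintegral_prod_symm _ hmeas.aemeasurable]
  have hinner : ∀ t : ℝ, ∫⁻ x : ℝ, ‖scaledWave 0 (x, t)‖ₑ ^ 6 =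
      ENNReal.ofReal ((2 * Real.pi) ^ 3 * √(Real.pi / 3) * (1 + t ^ 2)⁻¹) := fun t => by
    have hs : √(1 + t ^ 2) ^ 2 = 1 + t ^ 2 := Real.sq_sqrt (by positivity)
    calc _ = ∫⁻ x : ℝ, ENNReal.ofReal ((2 * Real.pi) ^ 3 / √(1 + t ^ 2) ^ 3 *
          Real.exp (-(3 / (1 + t ^ 2)) * x ^ 2)) := by
          refine lintegral_congr fun x => ?_
          rw [← ofReal_norm, ← ENNReal.ofReal_pow (norm_nonneg _), norm_scaledWave_zero_pow]
      _ = _ := by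
          rw [lintegral_ofReal_gaussian (by positivity) (by positivity),
            show Real.pi / (3 / (1 + t ^ 2)) = Real.pi / 3 * (1 + t ^ 2) by field_simp,
            Real.sqrt_mul (by positivity)]
          congr 1
          rw [show √(1 + t ^ 2) ^ 3 = (1 + t ^ 2) * √(1 + t ^ 2) by rw [← hs]; simp; ring]
          field_simp
  rw [lintegral_congr hinner, ← ofReal_integral_eq_lintegral_ofReal
    (integrable_inv_one_add_sq.const_mul _) (Eventually.of_forall fun t => by positivity),
    integral_const_mul, integral_univ_inv_one_add_sq]

lemma le_optimalConstant : ENNReal.ofReal sharpConstant ≤ optimalConstant 6 := by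
  have h := lintegral_scaledWave_zero_le
  have hconst : (2 * Real.pi) ^ 3 * √(Real.pi / 3) * Real.pi = normBound * √Real.pi ^ 3 := by
    have hpi : √Real.pi ^ 2 = Real.pi := Real.sq_sqrt Real.pi_pos.le
    rw [normBound, Real.sqrt_div Real.pi_pos.le, pow_succ √Real.pi, hpi]
    ring
  rw [lintegral_scaledWave_zero, hconst, ENNReal.ofReal_mul normBound_pos.le,
    ENNReal.ofReal_pow (Real.sqrt_nonneg _), ENNReal.mul_le_mul_iff_left
      (pow_ne_zero _ (by simp [Real.pi_pos])) (ENNReal.pow_ne_top ENNReal.ofReal_ne_top),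
    ← sharpConstant_pow, ENNReal.ofReal_pow sharpConstant_pos.le] at h
  exact (ENNReal.pow_le_pow_left_iff (by norm_num)).1 h

/-! ### Conclusion. -/

theorem optimalConstant_six : optimalConstant 6 = ENNReal.ofReal sharpConstant :=
  le_antisymm optimalConstant_le le_optimalConstant

theorem not_exists_isExtremizer_six : ¬ ∃ f : Lp ℂ 2 sigma, IsExtremizer 6 f := by
  rintro ⟨f, hf, heq⟩
  rw [extensionOperator_eq, optimalConstant_six] at heq
  exact (enorm_extensionL6_lt hf).ne heq

end Hyperbola

theorem theorem1 :
    (∃! T : Lp ℂ 2 Hyperbola.sigma →L[ℂ] Lp ℂ 6 (volume : Measure (ℝ × ℝ)),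
      Hyperbola.IsExtensionOperator 6 T) ∧
    Hyperbola.optimalConstant 6 =
      ENNReal.ofReal ((3 : ℝ) ^ (-(1 / 12) : ℝ) * (2 * Real.pi) ^ (1 / 2 : ℝ)) ∧
    ¬ ∃ f : Lp ℂ 2 Hyperbola.sigma, Hyperbola.IsExtremizer 6 f :=
  ⟨⟨Hyperbola.extensionL6, Hyperbola.isExtensionOperator_extensionL6,
    fun _ hT => hT.eq_extensionL6⟩, Hyperbola.optimalConstant_six,
    Hyperbola.not_exists_isExtremizer_six⟩
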